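/- For positive integers $a,b,c$, a plane partition in an $a\times b\times c$ box is a finite lower order ideal $\rho$ of $\mathbb{Z}_{\ge 1}^3$ (with the componentwise order) that is contained in $\{1,\dots,a\}\times\{1,\dots,b\}\times\{1,\dots,c\}$; its size is its number of elements. Let $\mathcal{X}_{a\times b\times c}[\mathrm{size}]$ denote the size of a plane partition chosen uniformly at random among all those in an $a\times b\times c$ box. For a real random variable (or distribution) $\mathcal{X}$ with mean $\mu$ and standard deviation $\sigma>0$, let $\mathcal{X}^*=(\mathcal{X}-\mu)/\sigma$ be its standardization. For $M\in\mathbb{Z}_{\ge 1}$, let $\mathcal{IH}_M$ be the $M$th Irwin--Hall distribution, that is, the distribution of the sum of $M$ independent continuous uniform $[0,1]$ random variables. Write $\Rightarrow$ for convergence in distribution. **Theorem.** Let $(a_n)$, $(b_n)$, $(c_n)$ be sequences of positive integers. As $n\to\infty$: (i) $\mathcal{X}_{a_n\times b_n\times c_n}[\mathrm{size}]^*\Rightarrow\mathcal{N}(0,1)$ if and only if $\mathrm{median}\{a_n,b_n,c_n\}\to\infty$. (ii) If $a_n b_n\to M<\infty$ and $c_n\to\infty$, then $\mathcal{X}_{a_n\times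 b_n\times c_n}[\mathrm{size}]^*\Rightarrow\mathcal{IH}_M^*$. -/

import Mathlib

open MeasureTheory ProbabilityTheory Filter Topology

/-- A plane partition: a finite set of unit cubes, indexed by the points of `ℤ_{≥ 1}³`, which is a
lower order ideal for the componentwise partial order. -/
@[ext]
structure PlanePartition where
  cubes : Finset (ℕ+ × ℕ+ × ℕ+)
  isLowerSet : IsLowerSet (cubes : Set (ℕ+ × ℕ+ × ℕ+))

namespace PlanePartition

/-- The size of a plane partition: its number of cubes. -/
def size (ρ : PlanePartition) : ℕ := ρ.cubes.card

/-- `PP(a × b × c)`: the plane partitions that fit in an `a × b × c` box. -/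
def box (a b c : ℕ) : Set PlanePartition :=
  {ρ | ∀ p ∈ ρ.cubes, (p.1 : ℕ) ≤ a ∧ (p.2.1 : ℕ) ≤ b ∧ (p.2.2 : ℕ) ≤ c}

theorem box_nonempty (a b c : ℕ) : (box a b c).Nonempty :=
  ⟨⟨∅, by simpa using isLowerSet_empty⟩, by simp [box]⟩

theorem box_finite (a b c : ℕ) : (box a b c).Finite := by
  have hinj : Function.Injective PlanePartition.cubes := fun _ _ h => PlanePartition.ext h
  refine Set.Finite.of_finite_image (f := PlanePartition.cubes)
    (Set.Finite.subset (Finset.finite_toSet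
      (Finset.Icc (1, 1, 1) (a.succPNat, b.succPNat, c.succPNat)).powerset) ?_) hinj.injOn
  rintro _ ⟨ρ, hρ, rfl⟩
  simp only [Finset.coe_powerset, Set.mem_preimage, Set.mem_powerset_iff, Finset.coe_subset]
  intro p hp
  obtain ⟨h1, h2, h3⟩ := hρ p hp
  rw [Finset.mem_Icc]
  refine ⟨⟨one_le, one_le, one_le⟩, ?_, ?_, ?_⟩ <;>
    rw [← PNat.coe_le_coe, Nat.succPNat_coe] <;> exact Nat.le_succ_of_le ‹_›

/-- Every set of plane partitions is measurable. -/
instance : MeasurableSpace PlanePartition := ⊤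

instance : DiscreteMeasurableSpace PlanePartition := ⟨fun _ => trivial⟩

/-- The uniform probability measure on the (finite, nonempty) set `PP(a × b × c)`. -/
noncomputable def uniformBox (a b c : ℕ) : Measure PlanePartition :=
  uniformOn (box a b c)

instance (a b c : ℕ) : IsProbabilityMeasure (uniformBox a b c) :=
  isProbabilityMeasure_uniformOn (box_finite a b c) (box_nonempty a b c)

end PlanePartition

/-- The standardization `X* = (X - E[X]) / σ(X)` of a real random variable `X` on the probability
space `(Ω, μ)`, where `σ(X)` is the square root of the variance of `X`. -/
noncomputable def standardize {Ω : Type*} [MeasurableSpace Ω] (X : Ω → ℝ) (μ : Measure Ω) :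
    Ω → ℝ :=
  fun ω => (X ω - ∫ ω', X ω' ∂μ) / Real.sqrt (variance X μ)

/-- The continuous uniform distribution on `[0, 1]`. -/
noncomputable def uniformUnit : Measure ℝ := volume.restrict (Set.Icc 0 1)

instance : IsProbabilityMeasure uniformUnit := ⟨by simp [uniformUnit]⟩

/-- The `M`th Irwin--Hall distribution: the law of the sum of `M` independent continuous uniform
`[0, 1]` random variables. -/
noncomputable def irwinHall (M : ℕ) : Measure ℝ :=
  (Measure.pi fun _ : Fin M => uniformUnit).map fun u => ∑ i, u i

instance (M : ℕ) : IsProbabilityMeasure (irwinHall M) :=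
  Measure.isProbabilityMeasure_map (by fun_prop)

/-- The median of three natural numbers. -/
def medianThree (a b c : ℕ) : ℕ := max (min a b) (min (max a b) c)

theorem medianThree_of_le {a b c : ℕ} (hab : a ≤ b) (hbc : b ≤ c) : medianThree a b c = b := by
  unfold medianThree; omega

theorem medianThree_swap_left (a b c : ℕ) : medianThree a b c = medianThree b a c := by
  unfold medianThree; omega

theorem medianThree_swap_right (a b c : ℕ) : medianThree a b c = medianThree a c b := by
  unfold medianThree; omega

/-! MacMahon's box formula writes the generating polynomial of the size as the product over `i < a`,
`j < b` of the q-integers `[i + j + c + 1]`, divided by the same product of the `[i + j + 1]`. Each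
q-integer is, up to a scalar, the generating polynomial of a discrete uniform variable, so means and
variances follow by subtraction. At `q = exp (i s)` each q-integer is a sinc up to phase and scale,
so the characteristic function of the centred size is a quotient of two products of sincs
(`PlanePartition.integral_exp_size_mul_prod`).

For (i), permuting the sides allows `a ≤ b ≤ c`, with median `b`. Expand `log (sinc x) = -x² / 6 +
O(x⁴)`. The quadratic terms add up to exactly `-t² / 2`, because they reproduce the variance. The
quartic error is `O(t⁴ / (a b))`, hence `O(t⁴ / b)` (`norm_boxCharFun_sub_le`). Conversely, the
standardized size never exceeds twice the median in absolute value, so a median that stays bounded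
along a subsequence is incompatible with the Gaussian tails.

For (ii), the product `a b` is eventually equal to `M`. As `c → ∞` the denominator sincs tend to `1`
and the `M` numerator sincs share one limit, which gives the characteristic function of the
standardized Irwin--Hall law. Lévy's continuity theorem does the rest.

The box formula itself comes from a bijection between plane partitions in the box and strict
Gelfand--Tsetlin patterns whose top row has one gap of length `c`. The q-count of such patterns is a
quotient of Vandermonde determinants (`gtSum_mul_prod`). -/

/-! ### Counting strict Gelfand--Tsetlin patterns by Vandermonde determinants. -/

/-- The sum of `q ^ (sum of the entries strictly below the top row)` over the strict
Gelfand--Tsetlin patterns with top row `l`: every row of length `n` interlaces the one of length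
`n + 1` above it, `l i ≤ m i < l (i + 1)`. -/
def gtSum {R : Type*} [CommRing R] (q : R) : (n : ℕ) → (Fin n → ℕ) → R
  | 0, _ => 1
  | n + 1, l => ∑ m ∈ Fintype.piFinset fun i : Fin n => Finset.Ico (l i.castSucc) (l i.succ),
      q ^ (∑ i, m i) * gtSum q n m

/-- Subtracting from each row its predecessor leaves a first column `(1, 0, …, 0)`, along which the
determinant is expanded. The remaining entries are differences of powers, ready to be read as
geometric sums over interlacing intervals. -/
theorem Matrix.det_vandermonde_eq_det_sub {R : Type*} [CommRing R] {n : ℕ} (v : Fin (n + 1) → R) :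
    (Matrix.vandermonde v).det =
      (Matrix.of fun i j : Fin n =>
        v i.succ ^ ((j : ℕ) + 1) - v i.castSucc ^ ((j : ℕ) + 1)).det := by
  let B : Matrix (Fin (n + 1)) (Fin (n + 1)) R := Matrix.of fun i j =>
    Fin.cases (v 0 ^ (j : ℕ)) (fun i' => v i'.succ ^ (j : ℕ) - v i'.castSucc ^ (j : ℕ)) i
  have h1 : (Matrix.vandermonde v).det = B.det := by
    refine Matrix.det_eq_of_forall_row_eq_smul_add_pred (fun _ => 1) ?_ ?_
    · intro j; simp [B, Matrix.vandermonde_apply]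
    · intro i j; simp [B, Matrix.vandermonde_apply]
  rw [h1, Matrix.det_succ_column_zero, Fin.sum_univ_succ]
  rw [Finset.sum_eq_zero]
  · simp only [B, Fin.val_zero, pow_zero, Matrix.of_apply, Fin.cases_zero, one_mul, add_zero]
    congr 1
  · intro i _
    simp [B]

theorem strictMono_of_interlacing {n : ℕ} {l : Fin (n + 1) → ℕ} {m : Fin n → ℕ}
    (hm : ∀ i, m i ∈ Finset.Ico (l i.castSucc) (l i.succ)) : StrictMono m := by
  cases n with
  | zero => exact fun i => i.elim0
  | succ n =>
    refine Fin.strictMono_iff_lt_succ.2 fun i => ?_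
    have h1 := Finset.mem_Ico.1 (hm i.castSucc)
    have h2 := Finset.mem_Ico.1 (hm i.succ)
    exact h1.2.trans_le h2.1

/-- A q-analogue of Weyl's dimension formula, by induction on the number of rows. Each difference of
powers is `q ^ (j + 1) - 1` times a geometric sum over one interlacing interval. The first factor
depends on the column only and comes out; multilinearity in the rows turns the rest into a sum over
interlacing rows `m` of smaller Vandermonde determinants. -/
theorem gtSum_mul_prod {R : Type*} [CommRing R] (q : R) {n : ℕ} {l : Fin n → ℕ}
    (hl : StrictMono l) :
    gtSum q n l * ∏ k ∈ Finset.range n, ∏ j ∈ Finset.range k, (q ^ (j + 1) - 1) =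
      (Matrix.vandermonde fun i => q ^ l i).det := by
  induction n with
  | zero => simp [gtSum]
  | succ n ih =>
    have hsum : ∀ i j : Fin n,
        (q ^ ((j : ℕ) + 1) - 1) * ∑ m ∈ Finset.Ico (l i.castSucc) (l i.succ),
          (q ^ ((j : ℕ) + 1)) ^ m =
        (q ^ l i.succ) ^ ((j : ℕ) + 1) - (q ^ l i.castSucc) ^ ((j : ℕ) + 1) := by
      intro i j
      rw [mul_comm, geom_sum_Ico_mul _ (hl.monotone (Fin.castSucc_lt_succ).le)]
      simp only [← pow_mul, mul_comm]
    rw [Matrix.det_vandermonde_eq_det_sub]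
    simp_rw [← hsum]
    rw [show (Matrix.of fun i j : Fin n => (q ^ ((j : ℕ) + 1) - 1) *
        ∑ m ∈ Finset.Ico (l i.castSucc) (l i.succ), (q ^ ((j : ℕ) + 1)) ^ m) =
      Matrix.of fun i j : Fin n => (fun j : Fin n => q ^ ((j : ℕ) + 1) - 1) j *
        (Matrix.of fun i j : Fin n => ∑ m ∈ Finset.Ico (l i.castSucc) (l i.succ),
          (q ^ ((j : ℕ) + 1)) ^ m) i j from rfl, Matrix.det_mul_row]
    have hdet : (Matrix.of fun i j : Fin n => ∑ m ∈ Finset.Ico (l i.castSucc) (l i.succ),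
          (q ^ ((j : ℕ) + 1)) ^ m).det =
        ∑ m ∈ Fintype.piFinset fun i : Fin n => Finset.Ico (l i.castSucc) (l i.succ),
          (q ^ (∑ i, m i) * (Matrix.vandermonde fun i => q ^ m i).det) := by
      have := (Matrix.detRowAlternating (n := Fin n) (R := R)).toMultilinearMap.map_sum_finset
        (fun i (m : ℕ) => fun j : Fin n => (q ^ ((j : ℕ) + 1)) ^ m)
        (fun i => Finset.Ico (l i.castSucc) (l i.succ))
      have h2 : (Matrix.of fun i j : Fin n => ∑ m ∈ Finset.Ico (l i.castSucc) (l i.succ),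
          (q ^ ((j : ℕ) + 1)) ^ m) = fun i => ∑ m ∈ Finset.Ico (l i.castSucc) (l i.succ),
          fun j : Fin n => (q ^ ((j : ℕ) + 1)) ^ m := by
        ext i j; simp [Finset.sum_apply]
      rw [h2]
      refine this.trans (Finset.sum_congr rfl fun m _ => ?_)
      -- Since `(q ^ (j + 1)) ^ m = q ^ m * (q ^ m) ^ j`, row `i` is `q ^ m i` times a Vandermonde
      -- row.
      rw [← Finset.prod_pow_eq_pow_sum, ← Matrix.det_mul_column]
      change Matrix.det _ = _
      congr 1
      ext i j
      simp only [Matrix.of_apply, Matrix.vandermonde_apply, ← pow_mul, ← pow_add]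
      congr 1
      ring
    rw [hdet, gtSum, Finset.prod_range_succ, Finset.sum_mul, Finset.mul_sum]
    refine Finset.sum_congr rfl fun m hm => ?_
    rw [Fintype.mem_piFinset] at hm
    rw [← ih (strictMono_of_interlacing hm),
      Fin.prod_univ_eq_prod_range (fun j => q ^ (j + 1) - 1) n]
    ring

theorem Matrix.det_vandermonde_range {R : Type*} [CommRing R] (n : ℕ) (v : ℕ → R) :
    (Matrix.vandermonde fun i : Fin n => v i).det =
      ∏ k ∈ Finset.range n, ∏ i ∈ Finset.range k, (v k - v i) := by
  rw [Matrix.det_vandermonde, Finset.prod_comm' (t' := Finset.univ) (s' := fun j => Finset.Iio j)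
    (by simp), ← Fin.prod_univ_eq_prod_range (fun k => ∏ i ∈ Finset.range k, (v k - v i)) n]
  refine Finset.prod_congr rfl fun k _ => ?_
  have := Finset.prod_map (Finset.Iio k) Fin.valEmbedding (fun i => v k - v i)
  rw [Fin.map_valEmbedding_Iio] at this
  rw [← Nat.Iio_eq_range, this]
  rfl

/-! ### The Vandermonde product of a top row with one gap. -/

/-- The top row `0, …, b - 1, b + c, …, a + b + c - 1`, as a function of the index. -/
def boxRow (b c i : ℕ) : ℕ := if b ≤ i then i + c else i

theorem boxRow_strictMono (b c : ℕ) : StrictMono (boxRow b c) := by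
  intro i j hij
  unfold boxRow
  split_ifs <;> omega

/-- The pairs `i < b ≤ k` are those that straddle the gap of `boxRow`, the only ones whose
difference changes with `c`. -/
theorem prod_range_pairs_ite {M : Type*} [CommMonoid M] (a b : ℕ) (f : ℕ → M) :
    ∏ k ∈ Finset.range (a + b), ∏ i ∈ Finset.range k, (if i < b ∧ b ≤ k then f (k - i) else 1) =
      ∏ i ∈ Finset.range a, ∏ j ∈ Finset.range b, f (i + j + 1) := by
  rw [add_comm a b, Finset.prod_range_add, Finset.prod_eq_one, one_mul]
  · refine Finset.prod_congr rfl fun k _ => ?_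
    rw [Finset.prod_range_add, ← Finset.prod_range_reflect,
      Finset.prod_eq_one (s := Finset.range k), mul_one]
    · refine Finset.prod_congr rfl fun j hj => ?_
      have := Finset.mem_range.1 hj
      rw [if_pos (by omega)]
      congr 1
      omega
    · intro i _
      exact if_neg (by omega)
  · intro k hk
    refine Finset.prod_eq_one fun i _ => if_neg ?_
    have := Finset.mem_range.1 hk
    omega

/-- Compared with the row `0, …, a + b - 1`, a pair above the gap gains a factor `q ^ c`, a pair
below it is unchanged, and a straddling pair at distance `h` has `q ^ h - 1` replaced by `q ^ (h +
c) - 1`. -/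
theorem prod_boxRow_sub {R : Type*} [CommRing R] (q : R) (a b c : ℕ) :
    (∏ k ∈ Finset.range (a + b), ∏ i ∈ Finset.range k, (q ^ boxRow b c k - q ^ boxRow b c i)) *
        ∏ i ∈ Finset.range a, ∏ j ∈ Finset.range b, (q ^ (i + j + 1) - 1) =
      q ^ (∑ k ∈ Finset.range (a + b), ∑ i ∈ Finset.range k, if b ≤ i then c else 0) *
        (∏ k ∈ Finset.range (a + b), ∏ i ∈ Finset.range k, (q ^ k - q ^ i)) *
        ∏ i ∈ Finset.range a, ∏ j ∈ Finset.range b, (q ^ (i + j + 1 + c) - 1) := by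
  rw [← prod_range_pairs_ite a b fun h => q ^ h - 1,
    ← prod_range_pairs_ite a b fun h => q ^ (h + c) - 1]
  simp_rw [← Finset.prod_pow_eq_pow_sum, ← Finset.prod_mul_distrib]
  refine Finset.prod_congr rfl fun k _ => Finset.prod_congr rfl fun i hi => ?_
  obtain ⟨d, rfl⟩ := Nat.exists_eq_add_of_lt (Finset.mem_range.1 hi)
  have hd : i + d + 1 - i = d + 1 := by omega
  simp only [boxRow, hd]
  split_ifs <;> first | omega | ring

theorem prod_range_pow_sub {R : Type*} [CommRing R] (q : R) (n : ℕ) :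
    ∏ k ∈ Finset.range n, ∏ i ∈ Finset.range k, (q ^ k - q ^ i) =
      q ^ (∑ k ∈ Finset.range n, ∑ i ∈ Finset.range k, i) *
        ∏ k ∈ Finset.range n, ∏ j ∈ Finset.range k, (q ^ (j + 1) - 1) := by
  simp_rw [← Finset.prod_pow_eq_pow_sum, ← Finset.prod_mul_distrib]
  refine Finset.prod_congr rfl fun k _ => ?_
  rw [Finset.prod_mul_distrib, ← Finset.prod_range_reflect (fun j => q ^ (j + 1) - 1),
    ← Finset.prod_mul_distrib]
  refine Finset.prod_congr rfl fun i hi => ?_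
  obtain ⟨d, rfl⟩ := Nat.exists_eq_add_of_lt (Finset.mem_range.1 hi)
  have hd : i + d + 1 - 1 - i = d := by omega
  rw [hd]
  ring

/-! ### Patterns as triangular arrays. -/

/-- `T k i`, for `i < k ≤ n`, are the entries of a strict Gelfand--Tsetlin pattern with top row
`T n = l`; all the other values of `T` are zero. -/
structure IsGTPattern (n : ℕ) (l : Fin n → ℕ) (T : ℕ → ℕ → ℕ) : Prop where
  top : ∀ i : Fin n, T n i = l i
  le : ∀ k i, i < k → k < n → T (k + 1) i ≤ T k i
  lt : ∀ k i, i < k → k < n → T k i < T (k + 1) (i + 1)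
  zero : ∀ k i, ¬(i < k ∧ k ≤ n) → T k i = 0

/-- The patterns are grouped by their second row from the top, which matches the recursion of
`gtSum`. The convention that `T` vanishes outside the triangle makes erasing and restoring the top
row mutually inverse. -/
theorem sum_eq_gtSum {R : Type*} [CommRing R] (q : R) {n : ℕ} {l : Fin n → ℕ}
    {s : Finset (ℕ → ℕ → ℕ)} (hs : ∀ T, T ∈ s ↔ IsGTPattern n l T) :
    ∑ T ∈ s, q ^ (∑ k ∈ Finset.range n, ∑ i ∈ Finset.range k, T k i) = gtSum q n l := by
  classical
  induction n generalizing s with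
  | zero =>
    have : s = {fun _ _ => 0} := by
      ext T
      rw [hs, Finset.mem_singleton]
      constructor
      · intro h
        ext k i
        exact h.zero k i (by omega)
      · rintro rfl
        exact ⟨fun i => i.elim0, by simp, by simp, by simp⟩
    simp [this, gtSum]
  | succ n ih =>
    have hmaps : ∀ T ∈ s, (fun i : Fin n => T n i) ∈
        Fintype.piFinset fun i : Fin n => Finset.Ico (l i.castSucc) (l i.succ) := by
      intro T hT
      rw [hs] at hT
      rw [Fintype.mem_piFinset]
      intro i
      have h1 := hT.le n i i.2 (by omega)
      have h2 := hT.lt n i i.2 (by omega)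
      have h3 := hT.top i.castSucc
      have h4 := hT.top i.succ
      simp only [Fin.val_castSucc, Fin.val_succ] at h3 h4
      rw [Finset.mem_Ico]
      omega
    rw [gtSum, ← Finset.sum_fiberwise_of_maps_to hmaps]
    refine Finset.sum_congr rfl fun m hm => ?_
    rw [Fintype.mem_piFinset] at hm
    set F := s.filter fun T => (fun i : Fin n => T n i) = m with hF
    let tr : (ℕ → ℕ → ℕ) → ℕ → ℕ → ℕ := fun T => Function.update T (n + 1) 0
    have htr : ∀ T k i, k ≠ n + 1 → tr T k i = T k i := by
      intro T k i hk
      simp [tr, Function.update_of_ne hk]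
    have htr' : ∀ T i, tr T (n + 1) i = 0 := by
      intro T i; simp [tr]
    have hinj : Set.InjOn tr F := by
      intro T hT T' hT' h
      have hTs := (hs T).1 (Finset.mem_filter.1 (Finset.mem_coe.1 hT)).1
      have hTs' := (hs T').1 (Finset.mem_filter.1 (Finset.mem_coe.1 hT')).1
      ext k i
      by_cases hk : k = n + 1
      · subst hk
        by_cases hi : i < n + 1
        · rw [hTs.top ⟨i, hi⟩, hTs'.top ⟨i, hi⟩]
        · rw [hTs.zero _ _ (by omega), hTs'.zero _ _ (by omega)]
      · rw [← htr T k i hk, ← htr T' k i hk, h]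
    have hmem : ∀ T, T ∈ F.image tr ↔ IsGTPattern n m T := by
      intro T
      rw [Finset.mem_image]
      constructor
      · rintro ⟨T, hT, rfl⟩
        obtain ⟨hT1, hT2⟩ := Finset.mem_filter.1 hT
        rw [hs] at hT1
        refine ⟨fun i => ?_, fun k i hi hk => ?_, fun k i hi hk => ?_, fun k i hk => ?_⟩
        · rw [htr _ _ _ (by omega), ← hT2]
        · rw [htr _ _ _ (by omega), htr _ _ _ (by omega)]
          exact hT1.le k i hi (by omega)
        · rw [htr _ _ _ (by omega), htr _ _ _ (by omega)]
          exact hT1.lt k i hi (by omega)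
        · by_cases h : k = n + 1
          · rw [h, htr']
          · rw [htr _ _ _ h]
            exact hT1.zero k i (by omega)
      · intro hT
        let T' : ℕ → ℕ → ℕ :=
          Function.update T (n + 1) fun i => if h : i < n + 1 then l ⟨i, h⟩ else 0
        have hT' : ∀ k i, k ≠ n + 1 → T' k i = T k i := by
          intro k i hk
          simp [T', Function.update_of_ne hk]
        have hT'' : ∀ i, T' (n + 1) i = if h : i < n + 1 then l ⟨i, h⟩ else 0 := by
          intro i; simp [T']
        refine ⟨T', Finset.mem_filter.2 ⟨(hs T').2 ⟨?_, ?_, ?_, ?_⟩, ?_⟩, ?_⟩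
        · intro i
          rw [hT'', dif_pos i.2]
        · intro k i hi hk
          by_cases h : k = n
          · subst h
            rw [hT'', dif_pos (by omega), hT' _ _ (by omega), hT.top ⟨i, hi⟩]
            exact (Finset.mem_Ico.1 (hm ⟨i, hi⟩)).1
          · rw [hT' _ _ (by omega), hT' _ _ (by omega)]
            exact hT.le k i hi (by omega)
        · intro k i hi hk
          by_cases h : k = n
          · subst h
            rw [hT'', dif_pos (by omega), hT' _ _ (by omega), hT.top ⟨i, hi⟩]
            exact (Finset.mem_Ico.1 (hm ⟨i, hi⟩)).2
          · rw [hT' _ _ (by omega), hT' _ _ (by omega)]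
            exact hT.lt k i hi (by omega)
        · intro k i hk
          by_cases h : k = n + 1
          · subst h
            rw [hT'', dif_neg (by omega)]
          · rw [hT' _ _ h]
            exact hT.zero k i (by omega)
        · ext i
          rw [hT' _ _ (by omega), hT.top]
        · ext k i
          by_cases h : k = n + 1
          · subst h
            rw [htr', hT.zero _ _ (by omega)]
          · rw [htr _ _ _ h, hT' _ _ h]
    rw [← ih hmem, Finset.sum_image hinj, Finset.mul_sum]
    refine Finset.sum_congr rfl fun T hT => ?_
    rw [← pow_add, Finset.sum_range_succ, add_comm]
    congr 2
    · rw [← (Finset.mem_filter.1 hT).2, ← Fin.sum_univ_eq_sum_range (fun i => T n i) n]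
    · refine Finset.sum_congr rfl fun k hk => Finset.sum_congr rfl fun i _ => ?_
      rw [htr _ _ _ (by have := Finset.mem_range.1 hk; omega)]

/-! ### Plane partitions as height functions and as patterns; the box formula. -/

namespace PlanePartition

/-- The number of cubes of `ρ` above the square `(x + 1, y + 1)` of the floor. -/
def height (ρ : PlanePartition) (x y : ℕ) : ℕ :=
  (ρ.cubes.filter fun p => p.1 = x.succPNat ∧ p.2.1 = y.succPNat).card

/-- A column of a lower order ideal is an initial segment, so it is determined by its cardinality.
-/
theorem mem_cubes_iff (ρ : PlanePartition) (x y : ℕ) (z : ℕ+) :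
    (x.succPNat, y.succPNat, z) ∈ ρ.cubes ↔ (z : ℕ) ≤ ρ.height x y := by
  classical
  constructor
  · intro h
    have : ((Finset.Icc 1 z).image fun w => (x.succPNat, y.succPNat, w)) ⊆
        ρ.cubes.filter fun p => p.1 = x.succPNat ∧ p.2.1 = y.succPNat := by
      intro p hp
      obtain ⟨w, hw, rfl⟩ := Finset.mem_image.1 hp
      refine Finset.mem_filter.2 ⟨?_, rfl, rfl⟩
      exact ρ.isLowerSet (show (x.succPNat, y.succPNat, w) ≤ (x.succPNat, y.succPNat, z) from
        ⟨le_rfl, le_rfl, (Finset.mem_Icc.1 hw).2⟩) h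
    have h2 := Finset.card_le_card this
    rw [Finset.card_image_of_injective _ (fun _ _ h => by simpa using h), PNat.card_Icc] at h2
    simp only [PNat.val_ofNat, Nat.add_sub_cancel] at h2
    exact h2
  · intro h
    by_contra hz
    have : ρ.cubes.filter (fun p => p.1 = x.succPNat ∧ p.2.1 = y.succPNat) ⊆
        (Finset.Ico 1 z).image fun w => (x.succPNat, y.succPNat, w) := by
      rintro ⟨p1, p2, w⟩ hp
      obtain ⟨hp, rfl, rfl⟩ := Finset.mem_filter.1 hp
      refine Finset.mem_image.2 ⟨w, Finset.mem_Ico.2 ⟨one_le, ?_⟩, rfl⟩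
      by_contra hw
      exact hz (ρ.isLowerSet (show (x.succPNat, y.succPNat, z) ≤ (x.succPNat, y.succPNat, w) from
        ⟨le_rfl, le_rfl, not_lt.1 hw⟩) hp)
    have h2 := (Finset.card_le_card this).trans Finset.card_image_le
    rw [PNat.card_Ico] at h2
    have := z.pos
    simp only [PNat.val_ofNat] at h2
    change _ ≤ Finset.card _ at h
    omega

theorem mem_cubes_iff_natPred (ρ : PlanePartition) (p : ℕ+ × ℕ+ × ℕ+) :
    p ∈ ρ.cubes ↔ (p.2.2 : ℕ) ≤ ρ.height p.1.natPred p.2.1.natPred := by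
  rw [← mem_cubes_iff, PNat.succPNat_natPred, PNat.succPNat_natPred]

theorem height_injective : Function.Injective height := by
  intro ρ ρ' h
  ext p
  rw [mem_cubes_iff_natPred, mem_cubes_iff_natPred, h]

theorem height_anti (ρ : PlanePartition) {x x' y y' : ℕ} (hx : x ≤ x') (hy : y ≤ y') :
    ρ.height x' y' ≤ ρ.height x y := by
  rcases Nat.eq_zero_or_pos (ρ.height x' y') with h | h
  · omega
  · have h1 := (ρ.mem_cubes_iff x' y' ⟨_, h⟩).2 le_rfl
    exact (ρ.mem_cubes_iff x y ⟨_, h⟩).1 (ρ.isLowerSet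
      (show (x.succPNat, y.succPNat, (⟨_, h⟩ : ℕ+)) ≤ (x'.succPNat, y'.succPNat, ⟨_, h⟩) from
        ⟨Nat.succPNat_le_succPNat.2 hx, Nat.succPNat_le_succPNat.2 hy, le_rfl⟩) h1)

theorem height_le {ρ : PlanePartition} {a b c : ℕ} (hρ : ρ ∈ box a b c) (x y : ℕ) :
    ρ.height x y ≤ c := by
  rcases Nat.eq_zero_or_pos (ρ.height x y) with h | h
  · omega
  · exact (hρ _ ((ρ.mem_cubes_iff x y ⟨_, h⟩).2 le_rfl)).2.2

theorem height_eq_zero {ρ : PlanePartition} {a b c : ℕ} (hρ : ρ ∈ box a b c) {x y : ℕ}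
    (h : a ≤ x ∨ b ≤ y) : ρ.height x y = 0 := by
  by_contra h0
  have := hρ _ ((ρ.mem_cubes_iff x y ⟨_, Nat.pos_of_ne_zero h0⟩).2 le_rfl)
  simp only [Nat.succPNat_coe, PNat.mk_coe] at this
  omega

theorem size_eq_sum_height {ρ : PlanePartition} {a b c : ℕ} (hρ : ρ ∈ box a b c) :
    ρ.size = ∑ x ∈ Finset.range a, ∑ y ∈ Finset.range b, ρ.height x y := by
  rw [size, ← Finset.sum_product', Finset.card_eq_sum_card_fiberwise
    (f := fun p : ℕ+ × ℕ+ × ℕ+ => (p.1.natPred, p.2.1.natPred))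
    (t := Finset.range a ×ˢ Finset.range b)]
  · refine Finset.sum_congr rfl fun xy _ => ?_
    unfold height
    congr 1
    refine Finset.filter_congr fun p _ => ?_
    rw [Prod.ext_iff]
    constructor
    · rintro ⟨h1, h2⟩
      simp only at h1 h2
      rw [← h1, ← h2]
      simp
    · rintro ⟨h1, h2⟩
      simp [h1, h2]
  · intro p hp
    have := hρ p hp
    have h1 := PNat.natPred_add_one p.1
    have h2 := PNat.natPred_add_one p.2.1
    simp only [Finset.coe_product, Finset.coe_range, Set.mem_prod, Set.mem_Iio]
    omega

theorem exists_height_eq {a b c : ℕ} {h : ℕ → ℕ → ℕ}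
    (hanti : ∀ x x' y y', x ≤ x' → y ≤ y' → h x' y' ≤ h x y) (hle : ∀ x y, h x y ≤ c)
    (hzero : ∀ x y, a ≤ x ∨ b ≤ y → h x y = 0) : ∃ ρ ∈ box a b c, ρ.height = h := by
  classical
  let S : Finset (ℕ+ × ℕ+ × ℕ+) :=
    (Finset.Icc (1, 1, 1) (a.succPNat, b.succPNat, c.succPNat)).filter fun p =>
      (p.2.2 : ℕ) ≤ h p.1.natPred p.2.1.natPred
  have hbd : ∀ p : ℕ+ × ℕ+ × ℕ+, (p.2.2 : ℕ) ≤ h p.1.natPred p.2.1.natPred →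
      (p.1 : ℕ) ≤ a ∧ (p.2.1 : ℕ) ≤ b ∧ (p.2.2 : ℕ) ≤ c := by
    intro p hp
    have h0 := p.2.2.pos
    have h1 := PNat.natPred_add_one p.1
    have h2 := PNat.natPred_add_one p.2.1
    have h3 := hle p.1.natPred p.2.1.natPred
    have h4 := hzero p.1.natPred p.2.1.natPred
    refine ⟨?_, ?_, by omega⟩
    · by_contra hc
      have := h4 (Or.inl (by omega))
      omega
    · by_contra hc
      have := h4 (Or.inr (by omega))
      omega
  have hS : ∀ p, p ∈ S ↔ (p.2.2 : ℕ) ≤ h p.1.natPred p.2.1.natPred := by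
    intro p
    refine ⟨fun hp => (Finset.mem_filter.1 hp).2, fun hp => Finset.mem_filter.2 ⟨?_, hp⟩⟩
    obtain ⟨h1, h2, h3⟩ := hbd p hp
    refine Finset.mem_Icc.2 ⟨⟨one_le, one_le, one_le⟩, ?_, ?_, ?_⟩ <;>
      rw [← PNat.coe_le_coe, Nat.succPNat_coe] <;> exact Nat.le_succ_of_le ‹_›
  let ρ : PlanePartition := ⟨S, by
    rintro p q ⟨h1, h2, h3⟩ hp
    rw [Finset.mem_coe, hS] at hp ⊢
    exact (PNat.coe_le_coe _ _).2 h3 |>.trans (hp.trans (hanti _ _ _ _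
      (PNat.natPred_monotone h1) (PNat.natPred_monotone h2)))⟩
  refine ⟨ρ, fun p hp => hbd p ((hS p).1 hp), ?_⟩
  ext x y
  have key : ∀ z : ℕ+, (z : ℕ) ≤ ρ.height x y ↔ (z : ℕ) ≤ h x y := by
    intro z
    rw [← mem_cubes_iff]
    refine (hS _).trans ?_
    simp
  refine le_antisymm ?_ ?_
  · rcases Nat.eq_zero_or_pos (ρ.height x y) with h0 | h0
    · omega
    · exact (key ⟨_, h0⟩).1 le_rfl
  · rcases Nat.eq_zero_or_pos (h x y) with h0 | h0
    · omega
    · exact (key ⟨_, h0⟩).2 le_rfl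

/-- The plane partitions in a box are the strict Gelfand--Tsetlin patterns with top row `boxRow`;
the entries that are not forced are, up to a shift, the heights. -/
def toGTPattern (a b c : ℕ) (ρ : PlanePartition) (k i : ℕ) : ℕ :=
  if i < k ∧ k ≤ a + b then i + ((if b ≤ i then c else 0) +
    if i < b then ρ.height (k - 1 - i) (b - 1 - i) else 0) else 0

theorem toGTPattern_injOn (a b c : ℕ) : Set.InjOn (toGTPattern a b c) (box a b c) := by
  intro ρ hρ ρ' hρ' h
  apply height_injective
  ext x y
  by_cases hx : a ≤ x ∨ b ≤ y
  · rw [height_eq_zero hρ hx, height_eq_zero hρ' hx]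
  · have := congrFun (congrFun h (x + 1 + (b - 1 - y))) (b - 1 - y)
    have h1 : x + 1 + (b - 1 - y) - 1 - (b - 1 - y) = x := by omega
    have h2 : b - 1 - (b - 1 - y) = y := by omega
    have h3 : ¬ b ≤ b - 1 - y := by omega
    have h4 : b - 1 - y < b := by omega
    have h5 : b - 1 - y < x + 1 + (b - 1 - y) ∧ x + 1 + (b - 1 - y) ≤ a + b := by omega
    simp only [toGTPattern, h1, h2, if_neg h3, if_pos h4, if_pos h5] at this
    omega

theorem isGTPattern_toGTPattern {ρ : PlanePartition} {a b c : ℕ} (hρ : ρ ∈ box a b c) :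
    IsGTPattern (a + b) (fun i => boxRow b c i) (toGTPattern a b c ρ) := by
  refine ⟨fun i => ?_, fun k i hi hk => ?_, fun k i hi hk => ?_, fun k i hk => ?_⟩
  · have := i.2
    rw [toGTPattern, if_pos (by omega), boxRow]
    split_ifs
    · omega
    · omega
    · rw [height_eq_zero hρ (Or.inl (by omega))]
      rfl
    · omega
  · have h1 := ρ.height_anti (show k - 1 - i ≤ k + 1 - 1 - i by omega) (le_refl (b - 1 - i))
    rw [toGTPattern, toGTPattern, if_pos (show i < k + 1 ∧ k + 1 ≤ a + b by omega),
      if_pos (show i < k ∧ k ≤ a + b by omega)]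
    split_ifs <;> omega
  · have h1 := ρ.height_anti (show k + 1 - 1 - (i + 1) ≤ k - 1 - i by omega)
      (show b - 1 - (i + 1) ≤ b - 1 - i by omega)
    have h2 := height_le hρ (k - 1 - i) (b - 1 - i)
    rw [toGTPattern, toGTPattern, if_pos (show i < k ∧ k ≤ a + b by omega),
      if_pos (show i + 1 < k + 1 ∧ k + 1 ≤ a + b by omega)]
    split_ifs <;> omega
  · rw [toGTPattern, if_neg hk]

end PlanePartition

namespace IsGTPattern

variable {n : ℕ} {l : Fin n → ℕ} {T : ℕ → ℕ → ℕ}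

theorem le_of_le (hT : IsGTPattern n l T) {k k' i : ℕ} (hi : i < k) (hk : k ≤ k') (hk' : k' ≤ n) :
    T k' i ≤ T k i := by
  induction k', hk using Nat.le_induction with
  | base => rfl
  | succ m hm ih => exact (hT.le m i (by omega) (by omega)).trans (ih (by omega))

theorem add_le_add (hT : IsGTPattern n l T) {k i : ℕ} (d : ℕ) (hi : i < k) (hk : k + d ≤ n) :
    T k i + d ≤ T (k + d) (i + d) := by
  induction d with
  | zero => rfl
  | succ d ih =>
    have h1 := ih (by omega)
    have h2 := hT.lt (k + d) (i + d) (by omega) (by omega)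
    rw [← add_assoc, ← add_assoc, ← add_assoc]
    omega

end IsGTPattern

namespace PlanePartition

/-- Going up a column bounds each entry below by a top-row entry (`hlow`); going up a diagonal
bounds it above (`hup`). The two bounds coincide for `i ≥ b` and for `k - 1 - i ≥ a`, so these
entries are forced; the others lie in a window of width `c` and give the heights. -/
theorem exists_toGTPattern_eq {a b c : ℕ} {T : ℕ → ℕ → ℕ}
    (hT : IsGTPattern (a + b) (fun i => boxRow b c i) T) :
    ∃ ρ ∈ box a b c, toGTPattern a b c ρ = T := by
  have hlow : ∀ k i, i < k → k ≤ a + b → boxRow b c i ≤ T k i := by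
    intro k i hi hk
    have h1 := hT.le_of_le hi hk le_rfl
    rwa [hT.top ⟨i, by omega⟩] at h1
  have hup : ∀ k i d, i < k → k + d = a + b → T k i + d ≤ boxRow b c (i + d) := by
    intro k i d hi hk
    have h1 := hT.add_le_add d hi hk.le
    rwa [hk, hT.top ⟨i + d, by omega⟩] at h1
  have hex : ∃ ρ ∈ box a b c, ρ.height = fun x y =>
      if x < a ∧ y < b then T (x + (b - y)) (b - 1 - y) - (b - 1 - y) else 0 := by
    refine exists_height_eq ?_ ?_ ?_
    · intro x x' y y' hx hy
      by_cases h' : x' < a ∧ y' < b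
      · rw [if_pos h', if_pos (by omega)]
        have h1 := hT.le_of_le (k := x + (b - y')) (k' := x' + (b - y')) (i := b - 1 - y')
          (by omega) (by omega) (by omega)
        have h2 := hT.add_le_add (k := x + (b - y')) (i := b - 1 - y') (y' - y) (by omega) (by omega)
        have e1 : x + (b - y') + (y' - y) = x + (b - y) := by omega
        have e2 : b - 1 - y' + (y' - y) = b - 1 - y := by omega
        rw [e1, e2] at h2
        omega
      · rw [if_neg h']
        exact Nat.zero_le _
    · intro x y
      split_ifs with h
      · have h2 := hup (x + (b - y)) (b - 1 - y) (a - x + y) (by omega) (by omega)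
        have h3 : boxRow b c (b - 1 - y + (a - x + y)) ≤ b - 1 - y + (a - x + y) + c := by
          unfold boxRow; split_ifs <;> omega
        omega
      · exact Nat.zero_le _
    · intro x y h
      rw [if_neg (by omega)]
  obtain ⟨ρ, hρ, hh⟩ := hex
  refine ⟨ρ, hρ, ?_⟩
  ext k i
  rw [toGTPattern, hh]
  by_cases hk : i < k ∧ k ≤ a + b
  · have h1 := hlow k i hk.1 hk.2
    have h2 := hup k i (a + b - k) hk.1 (by omega)
    rw [if_pos hk]
    unfold boxRow at h1 h2
    by_cases hb : i < b
    · rw [if_pos hb, if_neg (by omega)]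
      by_cases ha : k - 1 - i < a
      · have e1 : k - 1 - i + (b - (b - 1 - i)) = k := by omega
        have e2 : b - 1 - (b - 1 - i) = i := by omega
        simp only [e1, e2]
        rw [if_pos (by omega)]
        rw [if_neg (by omega)] at h1
        omega
      · simp only
        rw [if_neg (by omega)]
        rw [if_neg (by omega)] at h1 h2
        omega
    · rw [if_neg hb, if_pos (by omega)]
      rw [if_pos (by omega)] at h1 h2
      omega
  · rw [if_neg hk, hT.zero k i hk]

theorem sum_toGTPattern {ρ : PlanePartition} {a b c : ℕ} (hρ : ρ ∈ box a b c) :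
    ∑ k ∈ Finset.range (a + b), ∑ i ∈ Finset.range k, toGTPattern a b c ρ k i =
      (∑ k ∈ Finset.range (a + b), ∑ i ∈ Finset.range k, i) +
        ((∑ k ∈ Finset.range (a + b), ∑ i ∈ Finset.range k, if b ≤ i then c else 0) + ρ.size) := by
  have h1 : ∑ k ∈ Finset.range (a + b), ∑ i ∈ Finset.range k,
      (if i < b then ρ.height (k - 1 - i) (b - 1 - i) else 0) = ρ.size := by
    rw [size_eq_sum_height hρ]
    rcases Nat.eq_zero_or_pos (a + b) with h0 | h0
    · obtain ⟨rfl, rfl⟩ : a = 0 ∧ b = 0 := by omega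
      simp
    obtain ⟨N, hN⟩ : ∃ N, a + b = N + 1 := ⟨a + b - 1, by omega⟩
    rw [hN, Finset.sum_range_succ']
    simp only [Finset.range_zero, Finset.sum_empty, add_zero, Nat.add_sub_cancel]
    -- The height in position `(k, i)` is taken at `x = k - 1 - i`, `y = b - 1 - i`, so the triangle
    -- is summed again by `i` and `x`.
    rw [Finset.sum_range_diag_flip N
      fun i x => if i < b then ρ.height x (b - 1 - i) else 0]
    have h2 : ∀ i, i < b → ∑ x ∈ Finset.range (N - i), ρ.height x (b - 1 - i) =
        ∑ x ∈ Finset.range a, ρ.height x (b - 1 - i) := by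
      intro i hi
      refine (Finset.sum_subset (Finset.range_subset_range.2 (by omega)) fun x _ hx => ?_).symm
      exact height_eq_zero hρ (Or.inl (by simpa using hx))
    rw [Finset.sum_comm (s := Finset.range a),
      ← Finset.sum_range_reflect (fun y => ∑ x ∈ Finset.range a, ρ.height x y)]
    -- The range is enlarged to `N + b` so that it splits at `b` in every case. A new index below
    -- `b` exists only when `a = 0`, and then its sum is empty.
    have h3 : ∑ m ∈ Finset.range N, ∑ x ∈ Finset.range (N - m),
        (if m < b then ρ.height x (b - 1 - m) else 0) =
        ∑ m ∈ Finset.range (N + b),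
          if m < b then ∑ x ∈ Finset.range a, ρ.height x (b - 1 - m) else 0 := by
      refine (Finset.sum_congr rfl fun m _ => ?_).trans
        (Finset.sum_subset (Finset.range_subset_range.2 (by omega)) fun m hm hm' => ?_)
      · split_ifs with h
        · exact h2 m h
        · exact Finset.sum_const_zero
      · split_ifs with h
        · have : a = 0 := by simp at hm hm'; omega
          simp [this]
        · rfl
    rw [h3, add_comm N b, Finset.sum_range_add, Finset.sum_eq_zero (s := Finset.range N), add_zero]
    · exact Finset.sum_congr rfl fun m hm => if_pos (Finset.mem_range.1 hm)
    · intro m _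
      exact if_neg (by omega)
  rw [← h1]
  simp_rw [← Finset.sum_add_distrib]
  refine Finset.sum_congr rfl fun k hk => Finset.sum_congr rfl fun i hi => ?_
  rw [Finset.mem_range] at hk hi
  rw [toGTPattern, if_pos ⟨hi, hk.le⟩]

/-- **MacMahon's box formula**, denominators cleared. -/
theorem sum_pow_size_mul_prod {R : Type*} [CommRing R] [IsDomain R] {q : R}
    (hq : ∀ n : ℕ, q ^ (n + 1) ≠ 1) (hq0 : q ≠ 0) (a b c : ℕ) :
    (∑ ρ ∈ (box_finite a b c).toFinset, q ^ ρ.size) *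
        ∏ i ∈ Finset.range a, ∏ j ∈ Finset.range b, (q ^ (i + j + 1) - 1) =
      ∏ i ∈ Finset.range a, ∏ j ∈ Finset.range b, (q ^ (i + j + 1 + c) - 1) := by
  classical
  set E := ∑ k ∈ Finset.range (a + b), ∑ i ∈ Finset.range k, if b ≤ i then c else 0
  set E' := ∑ k ∈ Finset.range (a + b), ∑ i ∈ Finset.range k, i
  set C := ∏ k ∈ Finset.range (a + b), ∏ j ∈ Finset.range k, (q ^ (j + 1) - 1)
  -- This is where `q` must not be a root of unity; evaluation at such points is recovered later
  -- from the polynomial identity.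
  have hC : C ≠ 0 := Finset.prod_ne_zero_iff.2 fun k _ => Finset.prod_ne_zero_iff.2 fun j _ =>
    sub_ne_zero.2 (hq j)
  have h1 := sum_eq_gtSum q (n := a + b) (l := fun i => boxRow b c i)
    (s := (box_finite a b c).toFinset.image (toGTPattern a b c)) (by
      intro T
      rw [Finset.mem_image]
      constructor
      · rintro ⟨ρ, hρ, rfl⟩
        exact isGTPattern_toGTPattern ((box_finite a b c).mem_toFinset.1 hρ)
      · intro hT
        obtain ⟨ρ, hρ, h⟩ := exists_toGTPattern_eq hT
        exact ⟨ρ, (box_finite a b c).mem_toFinset.2 hρ, h⟩)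
  rw [Finset.sum_image (by simpa using toGTPattern_injOn a b c)] at h1
  have h2 : ∑ ρ ∈ (box_finite a b c).toFinset, q ^ (∑ k ∈ Finset.range (a + b),
      ∑ i ∈ Finset.range k, toGTPattern a b c ρ k i) =
      q ^ E' * q ^ E * ∑ ρ ∈ (box_finite a b c).toFinset, q ^ ρ.size := by
    rw [Finset.mul_sum]
    refine Finset.sum_congr rfl fun ρ hρ => ?_
    rw [sum_toGTPattern ((box_finite a b c).mem_toFinset.1 hρ), pow_add, pow_add, mul_assoc]
  have h3 := gtSum_mul_prod q (n := a + b) (l := fun i => boxRow b c i)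
    fun i j h => boxRow_strictMono b c h
  rw [← h1, h2, Matrix.det_vandermonde_range (a + b) fun i => q ^ boxRow b c i] at h3
  have h4 := prod_boxRow_sub q a b c
  rw [← h3, prod_range_pow_sub] at h4
  have h5 : q ^ E * (q ^ E' * C) ≠ 0 := mul_ne_zero (pow_ne_zero _ hq0)
    (mul_ne_zero (pow_ne_zero _ hq0) hC)
  refine mul_left_cancel₀ h5 ?_
  rw [← h4]
  ring

end PlanePartition

/-! ### Mean and variance of the size. -/

/-- If `P` is, up to a scalar, the generating polynomial of a random variable with values in `ℕ`,
that variable has mean `m` and variance `v`. -/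
structure Polynomial.HasMoments (P : Polynomial ℝ) (m v : ℝ) : Prop where
  eval_ne_zero : P.eval 1 ≠ 0
  mean : P.derivative.eval 1 = m * P.eval 1
  variance : P.derivative.derivative.eval 1 = (v + m ^ 2 - m) * P.eval 1

namespace Polynomial.HasMoments

open Polynomial

variable {P Q : ℝ[X]} {m v m' v' : ℝ}

theorem mul (hP : P.HasMoments m v) (hQ : Q.HasMoments m' v') :
    (P * Q).HasMoments (m + m') (v + v') where
  eval_ne_zero := by rw [eval_mul]; exact mul_ne_zero hP.1 hQ.1
  mean := by
    simp only [derivative_mul, eval_add, eval_mul, hP.mean, hQ.mean]; ring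
  variance := by
    simp only [derivative_mul, derivative_add, eval_add, eval_mul, hP.mean, hQ.mean, hP.variance,
      hQ.variance]
    ring

/-- The denominator of the box formula is handled by subtraction: the moments of a factor are those
of the product minus those of the other factor. -/
theorem of_mul (hPQ : (P * Q).HasMoments m v) (hQ : Q.HasMoments m' v') :
    P.HasMoments (m - m') (v - v') := by
  obtain ⟨h0, h1, h2⟩ := hPQ
  simp only [derivative_mul, derivative_add, eval_add, eval_mul, hQ.mean, hQ.variance] at h0 h1 h2
  have hQ0 := hQ.1
  have e1 : P.derivative.eval 1 = (m - m') * P.eval 1 :=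
    mul_right_cancel₀ hQ0 (by linear_combination h1)
  refine ⟨left_ne_zero_of_mul h0, e1, mul_right_cancel₀ hQ0 ?_⟩
  rw [e1] at h2
  linear_combination h2

theorem prod {ι : Type*} {s : Finset ι} {P : ι → ℝ[X]} {m v : ι → ℝ}
    (h : ∀ i ∈ s, (P i).HasMoments (m i) (v i)) :
    (∏ i ∈ s, P i).HasMoments (∑ i ∈ s, m i) (∑ i ∈ s, v i) := by
  classical
  induction s using Finset.induction_on with
  | empty => exact ⟨by simp, by simp, by simp⟩
  | insert i s hi ih =>
    rw [Finset.prod_insert hi, Finset.sum_insert hi, Finset.sum_insert hi]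
    exact (h i (Finset.mem_insert_self _ _)).mul
      (ih fun j hj => h j (Finset.mem_insert_of_mem hj))

theorem geom_sum (n : ℕ) :
    (∑ k ∈ Finset.range (n + 1), (X : ℝ[X]) ^ k).HasMoments (n / 2) (((n + 1 : ℝ) ^ 2 - 1) / 12) := by
  have h0 : ∀ n : ℕ, (∑ k ∈ Finset.range n, (X : ℝ[X]) ^ k).eval 1 = n := by
    intro n; simp [eval_finsetSum]
  have h1 : ∀ n : ℕ, (∑ k ∈ Finset.range n, (X : ℝ[X]) ^ k).derivative.eval 1 =
      n * (n - 1) / 2 := by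
    intro n
    induction n with
    | zero => simp
    | succ n ih =>
      rw [Finset.sum_range_succ, derivative_add, eval_add, ih]
      simp [derivative_X_pow]
      ring
  have h2 : ∀ n : ℕ, (∑ k ∈ Finset.range n, (X : ℝ[X]) ^ k).derivative.derivative.eval 1 =
      n * (n - 1) * (n - 2) / 3 := by
    intro n
    induction n with
    | zero => simp
    | succ n ih =>
      rw [Finset.sum_range_succ, derivative_add, derivative_add, eval_add, ih]
      rcases n with _ | n
      · simp
      · simp [derivative_X_pow, derivative_mul]
        ring
  refine ⟨?_, ?_, ?_⟩
  · rw [h0]; positivity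
  · rw [h0, h1]; push_cast; ring
  · rw [h0, h2]; push_cast; ring

end Polynomial.HasMoments

theorem sum_range_range_mean (a b c : ℕ) :
    ∑ i ∈ Finset.range a, ∑ j ∈ Finset.range b, (((i + j + c : ℕ) : ℝ) / 2) -
      ∑ i ∈ Finset.range a, ∑ j ∈ Finset.range b, (((i + j : ℕ) : ℝ) / 2) = a * b * c / 2 := by
  simp_rw [← Finset.sum_sub_distrib]
  rw [Finset.sum_congr rfl fun i _ => Finset.sum_congr rfl fun j _ =>
    show (((i + j + c : ℕ) : ℝ) / 2) - (((i + j : ℕ) : ℝ) / 2) = c / 2 by push_cast; ring]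
  simp
  ring

theorem sum_range_range_variance (a b c : ℕ) :
    ∑ i ∈ Finset.range a, ∑ j ∈ Finset.range b, ((((i + j + c : ℕ) : ℝ) + 1) ^ 2 - 1) / 12 -
      ∑ i ∈ Finset.range a, ∑ j ∈ Finset.range b, ((((i + j : ℕ) : ℝ) + 1) ^ 2 - 1) / 12 =
    (a * b * c * (a + b + c) / 12 : ℝ) := by
  have h1 : ∀ n : ℕ, ∑ i ∈ Finset.range n, (i : ℝ) = n * (n - 1) / 2 := by
    intro n
    induction n with
    | zero => simp
    | succ n ih => rw [Finset.sum_range_succ, ih]; push_cast; ring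
  simp_rw [← Finset.sum_sub_distrib]
  rw [Finset.sum_congr rfl fun i _ => Finset.sum_congr rfl fun j _ =>
    show ((((i + j + c : ℕ) : ℝ) + 1) ^ 2 - 1) / 12 - ((((i + j : ℕ) : ℝ) + 1) ^ 2 - 1) / 12 =
      c / 6 * i + c / 6 * j + (c / 6 + c ^ 2 / 12) by push_cast; ring]
  simp only [Finset.sum_add_distrib, ← Finset.mul_sum, h1, Finset.sum_const, Finset.card_range,
    nsmul_eq_mul]
  ring

namespace PlanePartition

open Polynomial in
/-- MacMahon's box formula, in terms of `q`-integers. -/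
theorem sum_X_pow_size_mul_prod {R : Type*} [CommRing R] [IsDomain R] (a b c : ℕ) :
    (∑ ρ ∈ (box_finite a b c).toFinset, (X : R[X]) ^ ρ.size) *
        ∏ i ∈ Finset.range a, ∏ j ∈ Finset.range b, ∑ k ∈ Finset.range (i + j + 1), X ^ k =
      ∏ i ∈ Finset.range a, ∏ j ∈ Finset.range b, ∑ k ∈ Finset.range (i + j + c + 1), X ^ k := by
  -- The indeterminate is nonzero and not a root of unity, so the formula applies to it; the common
  -- power of `X - 1` then cancels.
  have hX : ∀ n : ℕ, (X : R[X]) ^ (n + 1) ≠ 1 := fun n h => by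
    have := congrArg natDegree h
    simp at this
  have h := sum_pow_size_mul_prod hX X_ne_zero a b c
  have hne : ∏ i ∈ Finset.range a, ∏ j ∈ Finset.range b, ((X : R[X]) - 1) ≠ 0 :=
    Finset.prod_ne_zero_iff.2 fun _ _ => Finset.prod_ne_zero_iff.2 fun _ _ =>
      sub_ne_zero.2 (by simpa using hX 0)
  refine mul_right_cancel₀ hne ?_
  rw [mul_assoc]
  simp_rw [← Finset.prod_mul_distrib, geom_sum_mul]
  rw [h]
  simp_rw [add_right_comm _ 1 c]

open Polynomial in
-- Being the evaluation of a polynomial identity, this holds for every `q`: `q = 1` counts the box,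
-- and `q` on the unit circle gives the characteristic function.
theorem sum_pow_size_mul_prod_eval {R : Type*} [CommRing R] [IsDomain R] (q : R) (a b c : ℕ) :
    (∑ ρ ∈ (box_finite a b c).toFinset, q ^ ρ.size) *
        ∏ i ∈ Finset.range a, ∏ j ∈ Finset.range b, ∑ k ∈ Finset.range (i + j + 1), q ^ k =
      ∏ i ∈ Finset.range a, ∏ j ∈ Finset.range b, ∑ k ∈ Finset.range (i + j + c + 1), q ^ k := by
  have h := congrArg (Polynomial.eval q) (sum_X_pow_size_mul_prod (R := R) a b c)
  simpa [eval_finsetSum, eval_prod] using h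

open Polynomial in
theorem hasMoments_size (a b c : ℕ) :
    (∑ ρ ∈ (box_finite a b c).toFinset, (X : ℝ[X]) ^ ρ.size).HasMoments
      (a * b * c / 2) (a * b * c * (a + b + c) / 12) := by
  have h : ∀ c : ℕ, (∏ i ∈ Finset.range a, ∏ j ∈ Finset.range b,
      ∑ k ∈ Finset.range (i + j + c + 1), (X : ℝ[X]) ^ k).HasMoments _ _ := fun c =>
    HasMoments.prod fun i _ => HasMoments.prod fun j _ => HasMoments.geom_sum (i + j + c)
  have h1 := h c
  rw [← sum_X_pow_size_mul_prod] at h1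
  have h2 := h1.of_mul (h 0)
  simp only [add_zero] at h2
  rwa [sum_range_range_mean, sum_range_range_variance] at h2

theorem integral_uniformBox {E : Type*} [NormedAddCommGroup E] [NormedSpace ℝ E] [CompleteSpace E]
    (a b c : ℕ) (f : PlanePartition → E) :
    ∫ ρ, f ρ ∂uniformBox a b c =
      ((box_finite a b c).toFinset.card : ℝ)⁻¹ • ∑ ρ ∈ (box_finite a b c).toFinset, f ρ := by
  have hS : box a b c = ((box_finite a b c).toFinset : Set PlanePartition) := by simp
  rw [uniformBox, uniformOn, ProbabilityTheory.cond, integral_smul_measure]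
  conv_lhs => rw [hS]
  have hf : ∀ s : Finset PlanePartition, IntegrableOn f s Measure.count := fun s => by
    rw [← (s : Set PlanePartition).biUnion_of_singleton]
    simp [integrableOn_finset_iUnion]
  rw [setIntegral_finset _ (hf _), Measure.count_apply_finset]
  congr 1
  · simp
  · simp [Measure.real]

theorem ae_mem_box (a b c : ℕ) : ∀ᵐ ρ ∂uniformBox a b c, ρ ∈ box a b c := by
  have := box_finite a b c
  exact ae_cond_mem (this.measurableSet)

theorem size_le {ρ : PlanePartition} {a b c : ℕ} (hρ : ρ ∈ box a b c) : ρ.size ≤ a * b * c := by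
  rw [size_eq_sum_height hρ]
  refine (Finset.sum_le_sum fun x _ => Finset.sum_le_sum fun y _ => height_le hρ x y).trans ?_
  simp [mul_assoc]

theorem memLp_size (a b c : ℕ) :
    MemLp (fun ρ : PlanePartition => (ρ.size : ℝ)) 2 (uniformBox a b c) := by
  refine MemLp.of_bound Measurable.of_discrete.aestronglyMeasurable (a * b * c : ℕ) ?_
  filter_upwards [ae_mem_box a b c] with ρ hρ
  simpa using (by exact_mod_cast size_le hρ : (ρ.size : ℝ) ≤ (a * b * c : ℕ))

open Polynomial in
theorem integral_size (a b c : ℕ) :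
    ∫ ρ, (ρ.size : ℝ) ∂uniformBox a b c = a * b * c / 2 := by
  obtain ⟨h0, h1, -⟩ := hasMoments_size a b c
  simp [eval_finsetSum, derivative_X_pow] at h0 h1
  rw [integral_uniformBox, h1]
  have : ((box_finite a b c).toFinset.card : ℝ) ≠ 0 := by
    simpa using h0
  rw [smul_eq_mul]
  field_simp

open Polynomial in
theorem variance_size (a b c : ℕ) :
    variance (fun ρ : PlanePartition => (ρ.size : ℝ)) (uniformBox a b c) =
      a * b * c * (a + b + c) / 12 := by
  obtain ⟨h0, h1, h2⟩ := hasMoments_size a b c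
  -- Second derivatives give factorial moments: `n (n - 1) + n = n²`.
  have h3 : ∀ n : ℕ, ((X : ℝ[X]) ^ n).derivative.derivative.eval 1 + n = (n : ℝ) ^ 2 := by
    rintro (_ | n)
    · simp
    · simp [derivative_X_pow, derivative_mul]
      ring
  have hc : ((box_finite a b c).toFinset.card : ℝ) ≠ 0 := by
    simpa [eval_finsetSum] using h0
  have h4 : ∑ ρ ∈ (box_finite a b c).toFinset, (ρ.size : ℝ) ^ 2 =
      ((a * b * c * (a + b + c) / 12) + (a * b * c / 2) ^ 2) *
        ((box_finite a b c).toFinset.card : ℝ) := by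
    simp_rw [← h3]
    rw [Finset.sum_add_distrib]
    simp only [eval_finsetSum, derivative_sum, derivative_X_pow, eval_mul, eval_pow, eval_X,
      one_pow, mul_one, Finset.sum_const, nsmul_eq_mul, map_natCast, eval_natCast] at h1 h2 ⊢
    rw [h1, h2]
    ring
  rw [variance_eq_sub (memLp_size a b c), integral_size, integral_uniformBox]
  simp only [Pi.pow_apply]
  rw [h4, smul_eq_mul]
  field_simp
  ring

end PlanePartition

/-! ### Symmetry in the three sides and the standardized characteristic function. -/

namespace PlanePartition

/-- The image of a plane partition under an automorphism of the poset `ℤ_{≥ 1}³`. -/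
def mapEquiv (e : ℕ+ × ℕ+ × ℕ+ ≃o ℕ+ × ℕ+ × ℕ+) (ρ : PlanePartition) : PlanePartition where
  cubes := ρ.cubes.map e.toEquiv.toEmbedding
  isLowerSet := by
    rw [Finset.coe_map]
    exact ρ.isLowerSet.image e

theorem size_mapEquiv (e : ℕ+ × ℕ+ × ℕ+ ≃o ℕ+ × ℕ+ × ℕ+) (ρ : PlanePartition) :
    (ρ.mapEquiv e).size = ρ.size := Finset.card_map _

theorem mem_cubes_mapEquiv (e : ℕ+ × ℕ+ × ℕ+ ≃o ℕ+ × ℕ+ × ℕ+) (ρ : PlanePartition)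
    (p : ℕ+ × ℕ+ × ℕ+) : p ∈ (ρ.mapEquiv e).cubes ↔ e.symm p ∈ ρ.cubes := by
  simp only [mapEquiv, Finset.mem_map_equiv]
  rfl

theorem mapEquiv_symm_mapEquiv (e : ℕ+ × ℕ+ × ℕ+ ≃o ℕ+ × ℕ+ × ℕ+) (ρ : PlanePartition) :
    (ρ.mapEquiv e).mapEquiv e.symm = ρ := by
  ext p
  simp [mem_cubes_mapEquiv]

/-- Exchange of the first two coordinates. -/
def swapLeft : ℕ+ × ℕ+ × ℕ+ ≃o ℕ+ × ℕ+ × ℕ+ where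
  toFun p := (p.2.1, p.1, p.2.2)
  invFun p := (p.2.1, p.1, p.2.2)
  left_inv _ := rfl
  right_inv _ := rfl
  map_rel_iff' {p q} := by
    simp only [Equiv.coe_fn_mk, Prod.le_def]
    tauto

/-- Exchange of the last two coordinates. -/
def swapRight : ℕ+ × ℕ+ × ℕ+ ≃o ℕ+ × ℕ+ × ℕ+ where
  toFun p := (p.1, p.2.2, p.2.1)
  invFun p := (p.1, p.2.2, p.2.1)
  left_inv _ := rfl
  right_inv _ := rfl
  map_rel_iff' {p q} := by
    simp only [Equiv.coe_fn_mk, Prod.le_def]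
    tauto

theorem sum_box_mapEquiv {E : Type*} [AddCommMonoid E] (e : ℕ+ × ℕ+ × ℕ+ ≃o ℕ+ × ℕ+ × ℕ+)
    {a b c a' b' c' : ℕ} (h : ∀ ρ ∈ box a b c, ρ.mapEquiv e ∈ box a' b' c')
    (h' : ∀ ρ ∈ box a' b' c', ρ.mapEquiv e.symm ∈ box a b c) (f : ℕ → E) :
    ∑ ρ ∈ (box_finite a b c).toFinset, f ρ.size =
      ∑ ρ ∈ (box_finite a' b' c').toFinset, f ρ.size := by
  refine Finset.sum_nbij' (mapEquiv e) (mapEquiv e.symm) ?_ ?_ ?_ ?_ ?_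
  · simpa using h
  · simpa using h'
  · exact fun ρ _ => mapEquiv_symm_mapEquiv e ρ
  · exact fun ρ _ => mapEquiv_symm_mapEquiv e.symm ρ
  · exact fun ρ _ => by rw [size_mapEquiv]

theorem sum_box_swap_left {E : Type*} [AddCommMonoid E] (a b c : ℕ) (f : ℕ → E) :
    ∑ ρ ∈ (box_finite a b c).toFinset, f ρ.size =
      ∑ ρ ∈ (box_finite b a c).toFinset, f ρ.size := by
  have h : ∀ a b c, ∀ ρ ∈ box a b c, ρ.mapEquiv swapLeft ∈ box b a c := by
    intro a b c ρ hρ p hp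
    obtain ⟨h1, h2, h3⟩ := hρ _ ((mem_cubes_mapEquiv _ _ _).1 hp)
    exact ⟨h2, h1, h3⟩
  exact sum_box_mapEquiv swapLeft (h a b c) (h b a c) f

theorem sum_box_swap_right {E : Type*} [AddCommMonoid E] (a b c : ℕ) (f : ℕ → E) :
    ∑ ρ ∈ (box_finite a b c).toFinset, f ρ.size =
      ∑ ρ ∈ (box_finite a c b).toFinset, f ρ.size := by
  have h : ∀ a b c, ∀ ρ ∈ box a b c, ρ.mapEquiv swapRight ∈ box a c b := by
    intro a b c ρ hρ p hp
    obtain ⟨h1, h2, h3⟩ := hρ _ ((mem_cubes_mapEquiv _ _ _).1 hp)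
    exact ⟨h1, h3, h2⟩
  exact sum_box_mapEquiv swapRight (h a b c) (h a c b) f

theorem integral_size_swap_left (a b c : ℕ) (f : ℕ → ℂ) :
    ∫ ρ, f ρ.size ∂uniformBox a b c = ∫ ρ, f ρ.size ∂uniformBox b a c := by
  rw [integral_uniformBox, integral_uniformBox, sum_box_swap_left]
  congr 3
  simpa using sum_box_swap_left a b c fun _ => (1 : ℕ)

theorem integral_size_swap_right (a b c : ℕ) (f : ℕ → ℂ) :
    ∫ ρ, f ρ.size ∂uniformBox a b c = ∫ ρ, f ρ.size ∂uniformBox a c b := by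
  rw [integral_uniformBox, integral_uniformBox, sum_box_swap_right]
  congr 3
  simpa using sum_box_swap_right a b c fun _ => (1 : ℕ)

/-- The standard deviation of the size of a random plane partition in a box. -/
noncomputable def boxStd (a b c : ℕ) : ℝ := Real.sqrt (a * b * c * (a + b + c) / 12)

theorem boxStd_pos {a b c : ℕ} (ha : 0 < a) (hb : 0 < b) (hc : 0 < c) : 0 < boxStd a b c := by
  unfold boxStd; positivity

theorem standardize_size (a b c : ℕ) :
    standardize (fun ρ : PlanePartition => (ρ.size : ℝ)) (uniformBox a b c) =
      fun ρ => ((ρ.size : ℝ) - a * b * c / 2) / boxStd a b c := by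
  unfold standardize boxStd
  rw [integral_size, variance_size]

/-- The characteristic function of the standardized size. -/
noncomputable def boxCharFun (a b c : ℕ) (t : ℝ) : ℂ :=
  ∫ ρ, Complex.exp (t / boxStd a b c * (ρ.size - a * b * c / 2) * Complex.I) ∂uniformBox a b c

theorem charFun_map_standardize_size (a b c : ℕ) (t : ℝ) :
    charFun ((uniformBox a b c).map
      (standardize (fun ρ : PlanePartition => (ρ.size : ℝ)) (uniformBox a b c))) t =
      boxCharFun a b c t := by
  rw [charFun_apply_real, integral_map Measurable.of_discrete.aemeasurable (by fun_prop),
    standardize_size, boxCharFun]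
  congr 1
  ext ρ
  congr 1
  push_cast
  ring

theorem boxCharFun_swap_left (a b c : ℕ) : boxCharFun a b c = boxCharFun b a c := by
  ext t
  unfold boxCharFun boxStd
  rw [integral_size_swap_left a b c fun n => Complex.exp (_ * (n - a * b * c / 2) * Complex.I)]
  simp only [mul_comm (a : ℝ), mul_comm (a : ℂ), add_comm (a : ℝ)]

theorem boxCharFun_swap_right (a b c : ℕ) : boxCharFun a b c = boxCharFun a c b := by
  ext t
  unfold boxCharFun boxStd
  rw [integral_size_swap_right a b c fun n => Complex.exp (_ * (n - a * b * c / 2) * Complex.I)]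
  simp only [mul_right_comm (a : ℝ) b, mul_right_comm (a : ℂ) b, add_right_comm (a : ℝ) b]

theorem exists_sorted_boxCharFun_eq {a b c : ℕ} (ha : 0 < a) (hb : 0 < b) (hc : 0 < c) :
    ∃ a' b' c' : ℕ, 0 < a' ∧ a' ≤ b' ∧ b' ≤ c' ∧ medianThree a b c = b' ∧
      boxCharFun a b c = boxCharFun a' b' c' := by
  rcases le_total a b with h1 | h1 <;> rcases le_total b c with h2 | h2 <;>
    rcases le_total a c with h3 | h3
  · exact ⟨a, b, c, ha, h1, h2, medianThree_of_le h1 h2, rfl⟩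
  · exact ⟨a, b, c, ha, h1, h2, medianThree_of_le h1 h2, rfl⟩
  · exact ⟨a, c, b, ha, h3, h2, by rw [medianThree_swap_right, medianThree_of_le h3 h2],
      boxCharFun_swap_right a b c⟩
  · exact ⟨c, a, b, hc, h3, h1, by
      rw [medianThree_swap_right, medianThree_swap_left, medianThree_of_le h3 h1], by
      rw [boxCharFun_swap_right a b c, boxCharFun_swap_left a c b]⟩
  · exact ⟨b, a, c, hb, h1, h3, by rw [medianThree_swap_left, medianThree_of_le h1 h3],
      boxCharFun_swap_left a b c⟩
  · exact ⟨b, c, a, hb, h2, h3, by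
      rw [medianThree_swap_left, medianThree_swap_right, medianThree_of_le h2 h3], by
      rw [boxCharFun_swap_left a b c, boxCharFun_swap_right b a c]⟩
  all_goals exact ⟨c, b, a, hc, h2, h1, by
      rw [medianThree_swap_left, medianThree_swap_right, medianThree_swap_left,
        medianThree_of_le h2 h1], by
      rw [boxCharFun_swap_left a b c, boxCharFun_swap_right b a c, boxCharFun_swap_left b c a]⟩

end PlanePartition

/-! ### The characteristic function as a quotient of sinc products. -/

theorem sum_range_exp_mul_I (s : ℝ) (n : ℕ) :
    (Complex.exp (s * Complex.I) - 1) * ∑ k ∈ Finset.range n, Complex.exp (s * Complex.I) ^ k =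
      n * s * Complex.I * Complex.exp (n * s / 2 * Complex.I) * Real.sinc (n * s / 2) := by
  rw [mul_comm, geom_sum_mul, ← Complex.exp_nat_mul]
  rcases eq_or_ne ((n : ℝ) * s / 2) 0 with h | h
  · have h' : (n : ℂ) * s = 0 := by
      have : (n : ℝ) * s = 0 := by linarith
      exact_mod_cast this
    rw [← mul_assoc, h']
    simp
  · rw [Real.sinc_of_ne_zero h]
    have h' : (n : ℂ) * s / 2 ≠ 0 := by exact_mod_cast h
    push_cast
    rw [Complex.sin]
    set z : ℂ := n * s / 2 with hz
    have e1 : (n : ℂ) * (s * Complex.I) = z * Complex.I + z * Complex.I := by rw [hz]; ring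
    have e2 : (n : ℂ) * s = 2 * z := by rw [hz]; ring
    rw [e1, e2, Complex.exp_add, neg_mul, Complex.exp_neg]
    have := Complex.exp_ne_zero (z * Complex.I)
    field_simp
    linear_combination (Complex.exp (z * Complex.I) ^ 2 - 1) * Complex.I_sq

/-- The box formula at `q = exp (i s)`. The phases cancel against the centring at `a b c / 2`, and
the integer factors cancel against the number of partitions, which is the formula at `q = 1`. The
denominator stays on the left because its sincs may vanish. -/
theorem PlanePartition.integral_exp_size_mul_prod (a b c : ℕ) (s : ℝ) :
    (∫ ρ, Complex.exp (s * (ρ.size - a * b * c / 2) * Complex.I) ∂uniformBox a b c) *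
        ∏ i ∈ Finset.range a, ∏ j ∈ Finset.range b, (Real.sinc ((i + j + 1 : ℕ) * s / 2) : ℂ) =
      ∏ i ∈ Finset.range a, ∏ j ∈ Finset.range b, (Real.sinc ((i + j + c + 1 : ℕ) * s / 2) : ℂ) := by
  classical
  rcases eq_or_ne s 0 with rfl | hs
  · simp
  have hG := sum_pow_size_mul_prod_eval (Complex.exp (s * Complex.I)) a b c
  have hN := sum_pow_size_mul_prod_eval (1 : ℂ) a b c
  simp only [one_pow, Finset.sum_const, Finset.card_range, nsmul_eq_mul, mul_one] at hN
  have hint : ∫ ρ, Complex.exp (s * (ρ.size - a * b * c / 2) * Complex.I) ∂uniformBox a b c =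
      ((box_finite a b c).toFinset.card : ℂ)⁻¹ * (Complex.exp (-(a * b * c * s / 2 * Complex.I)) *
        ∑ ρ ∈ (box_finite a b c).toFinset, Complex.exp (s * Complex.I) ^ ρ.size) := by
    rw [integral_uniformBox, Finset.mul_sum, Complex.real_smul, Complex.ofReal_inv,
      Complex.ofReal_natCast]
    congr 1
    refine Finset.sum_congr rfl fun ρ _ => ?_
    rw [← Complex.exp_nat_mul, ← Complex.exp_add]
    congr 1
    ring
  have hcard : ((box_finite a b c).toFinset.card : ℂ) ≠ 0 := by
    rw [Nat.cast_ne_zero, ← Nat.pos_iff_ne_zero, Finset.card_pos]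
    simpa using box_nonempty a b c
  set G := ∑ ρ ∈ (box_finite a b c).toFinset, Complex.exp (s * Complex.I) ^ ρ.size
  set N := ((box_finite a b c).toFinset.card : ℂ)
  -- What remains of `(q - 1) [n]` once the sinc is removed.
  let A : ℕ → ℂ := fun n => n * s * Complex.I * Complex.exp (n * s / 2 * Complex.I)
  have hA : ∀ n : ℕ, A (n + 1) ≠ 0 := fun n => by
    simp only [A]
    refine mul_ne_zero (mul_ne_zero (mul_ne_zero ?_ ?_) Complex.I_ne_zero) (Complex.exp_ne_zero _)
    · exact_mod_cast n.succ_ne_zero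
    · exact_mod_cast hs
  have hq : ∀ c : ℕ, (∏ i ∈ Finset.range a, ∏ j ∈ Finset.range b,
        (Complex.exp (s * Complex.I) - 1)) * ∏ i ∈ Finset.range a, ∏ j ∈ Finset.range b,
        ∑ k ∈ Finset.range (i + j + c + 1), Complex.exp (s * Complex.I) ^ k =
      (∏ i ∈ Finset.range a, ∏ j ∈ Finset.range b, A (i + j + c + 1)) *
      ∏ i ∈ Finset.range a, ∏ j ∈ Finset.range b,
        (Real.sinc ((i + j + c + 1 : ℕ) * s / 2) : ℂ) := by
    intro c
    simp_rw [← Finset.prod_mul_distrib]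
    exact Finset.prod_congr rfl fun i _ => Finset.prod_congr rfl fun j _ =>
      sum_range_exp_mul_I s (i + j + c + 1)
  have hAc : N * (∏ i ∈ Finset.range a, ∏ j ∈ Finset.range b, A (i + j + 1)) *
      Complex.exp (a * b * c * s / 2 * Complex.I) =
      ∏ i ∈ Finset.range a, ∏ j ∈ Finset.range b, A (i + j + c + 1) := by
    have hE : Complex.exp (a * b * c * s / 2 * Complex.I) =
        ∏ i ∈ Finset.range a, ∏ j ∈ Finset.range b, Complex.exp (c * s / 2 * Complex.I) := by
      simp only [Finset.prod_const, Finset.card_range, ← Complex.exp_nat_mul]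
      congr 1
      ring
    have hsplit : ∀ n : ℕ, A n = n * (s * Complex.I * Complex.exp (n * s / 2 * Complex.I)) :=
      fun n => by simp only [A]; ring
    simp_rw [hsplit, Finset.prod_mul_distrib (f := fun j => ((_ + j + _ : ℕ) : ℂ)),
      Finset.prod_mul_distrib (f := fun j => ((_ + j + _ + _ : ℕ) : ℂ))]
    rw [Finset.prod_mul_distrib, Finset.prod_mul_distrib, ← mul_assoc, hN, mul_assoc]
    congr 1
    rw [hE]
    simp_rw [← Finset.prod_mul_distrib]
    refine Finset.prod_congr rfl fun i _ => Finset.prod_congr rfl fun j _ => ?_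
    rw [mul_assoc, ← Complex.exp_add]
    congr 2
    push_cast
    ring
  have h0 := hq 0
  simp only [add_zero] at h0
  have hne : ∏ i ∈ Finset.range a, ∏ j ∈ Finset.range b, A (i + j + c + 1) ≠ 0 :=
    Finset.prod_ne_zero_iff.2 fun i _ => Finset.prod_ne_zero_iff.2 fun j _ => hA _
  refine mul_left_cancel₀ hne ?_
  rw [← hq c, ← hG, hint, ← hAc, mul_left_comm _ G, h0, Complex.exp_neg]
  have := Complex.exp_ne_zero (a * b * c * s / 2 * Complex.I)
  field_simp
  simp only [mul_comm s]

/-! ### The Gaussian estimate. -/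

/-- With `u = 1 - sinc x`, the Taylor bound for the sine gives `u = x² / 6` up to order `x⁴` and `0
≤ u ≤ x² / 4`; then `log (1 - u)` differs from `-u` by at most `u² / (1 - u) ≤ x⁴ / 2`. -/
theorem exists_sinc_eq_exp {x : ℝ} (hx : |x| ≤ 1) :
    ∃ r : ℝ, |r| ≤ x ^ 4 ∧ Real.sinc x = Real.exp (-x ^ 2 / 6 + r) := by
  rcases eq_or_ne x 0 with rfl | h0
  · exact ⟨0, by simp⟩
  have hx2 : x ^ 2 ≤ 1 := by rw [← sq_abs]; exact pow_le_one₀ (abs_nonneg x) hx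
  have hx2' : 0 < x ^ 2 := by positivity
  have hs : |Real.sinc x - (1 - x ^ 2 / 6)| ≤ x ^ 4 / 100 := by
    have h := Real.sin_bound hx
    rw [Real.sinc_of_ne_zero h0]
    have : Real.sin x / x - (1 - x ^ 2 / 6) = (Real.sin x - (x - x ^ 3 / 6)) / x := by
      field_simp
    rw [this, abs_div, div_le_iff₀ (abs_pos.2 h0)]
    refine h.trans (le_of_eq ?_)
    have : x ^ 4 = |x| ^ 4 := by rw [← Even.pow_abs (by decide)]
    rw [this]
    ring
  obtain ⟨h1, h2⟩ := abs_le.1 hs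
  have hx4 : x ^ 4 = x ^ 2 * x ^ 2 := by ring
  set u := 1 - Real.sinc x with hu
  have hu0 : 0 ≤ u := by nlinarith
  have hu1 : u ≤ x ^ 2 / 4 := by nlinarith
  have hpos : 0 < 1 - u := by nlinarith
  have hlog := Real.abs_log_sub_add_sum_range_le (x := u) (by rw [abs_of_nonneg hu0]; linarith) 1
  simp only [Finset.sum_range_one, zero_add, pow_one, Nat.cast_zero, div_one, abs_of_nonneg hu0,
    Nat.reduceAdd] at hlog
  have hb : u ^ 2 / (1 - u) ≤ x ^ 4 / 2 := by
    rw [div_le_iff₀ hpos]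
    nlinarith [mul_self_le_mul_self hu0 hu1]
  obtain ⟨h3, h4⟩ := abs_le.1 (hlog.trans hb)
  refine ⟨Real.log (1 - u) + x ^ 2 / 6, ?_, ?_⟩
  · rw [abs_le]
    constructor <;> nlinarith
  · rw [neg_div, neg_add_cancel_comm_assoc, Real.exp_log hpos, hu]
    ring

theorem exists_prod_sinc_eq_exp (a b : ℕ) {f : ℕ → ℕ → ℝ} {D : ℝ} (hD : D ≤ 1)
    (hf : ∀ i < a, ∀ j < b, f i j ^ 2 ≤ D) :
    ∃ R : ℝ, |R| ≤ a * b * D ^ 2 ∧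
      ∏ i ∈ Finset.range a, ∏ j ∈ Finset.range b, Real.sinc (f i j) =
        Real.exp (-(∑ i ∈ Finset.range a, ∑ j ∈ Finset.range b, f i j ^ 2) / 6 + R) := by
  have h : ∀ i j, ∃ r : ℝ, i < a → j < b →
      |r| ≤ D ^ 2 ∧ Real.sinc (f i j) = Real.exp (-f i j ^ 2 / 6 + r) := by
    intro i j
    by_cases hij : i < a ∧ j < b
    · have h1 := hf i hij.1 j hij.2
      obtain ⟨r, hr, h⟩ := exists_sinc_eq_exp (x := f i j) (by
        rw [← sq_le_one_iff_abs_le_one]; exact h1.trans hD)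
      refine ⟨r, fun _ _ => ⟨hr.trans ?_, h⟩⟩
      calc f i j ^ 4 = (f i j ^ 2) ^ 2 := by ring
        _ ≤ D ^ 2 := pow_le_pow_left₀ (sq_nonneg _) h1 2
    · exact ⟨0, fun h1 h2 => absurd ⟨h1, h2⟩ hij⟩
  choose r hr using h
  refine ⟨∑ i ∈ Finset.range a, ∑ j ∈ Finset.range b, r i j, ?_, ?_⟩
  · calc |∑ i ∈ Finset.range a, ∑ j ∈ Finset.range b, r i j|
        ≤ ∑ i ∈ Finset.range a, ∑ j ∈ Finset.range b, |r i j| :=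
          (Finset.abs_sum_le_sum_abs _ _).trans
            (Finset.sum_le_sum fun i _ => Finset.abs_sum_le_sum_abs _ _)
      _ ≤ ∑ i ∈ Finset.range a, ∑ j ∈ Finset.range b, D ^ 2 :=
          Finset.sum_le_sum fun i hi => Finset.sum_le_sum fun j hj =>
            (hr i j (Finset.mem_range.1 hi) (Finset.mem_range.1 hj)).1
      _ = a * b * D ^ 2 := by simp; ring
  · rw [neg_div, Finset.sum_div, ← Finset.sum_neg_distrib, ← Finset.sum_add_distrib, Real.exp_sum]
    refine Finset.prod_congr rfl fun i hi => ?_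
    rw [Finset.sum_div, ← Finset.sum_neg_distrib, ← Finset.sum_add_distrib, Real.exp_sum]
    refine Finset.prod_congr rfl fun j hj => ?_
    rw [(hr i j (Finset.mem_range.1 hi) (Finset.mem_range.1 hj)).2, neg_div]

namespace PlanePartition

theorem boxCharFun_mul_prod (a b c : ℕ) (t : ℝ) :
    boxCharFun a b c t * (∏ i ∈ Finset.range a, ∏ j ∈ Finset.range b,
        Real.sinc ((i + j + 1 : ℕ) * (t / boxStd a b c) / 2) : ℝ) =
      (∏ i ∈ Finset.range a, ∏ j ∈ Finset.range b,
        Real.sinc ((i + j + c + 1 : ℕ) * (t / boxStd a b c) / 2) : ℝ) := by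
  have h := integral_exp_size_mul_prod a b c (t / boxStd a b c)
  push_cast at h ⊢
  rw [← h]
  rfl

theorem sq_boxStd (a b c : ℕ) : boxStd a b c ^ 2 = a * b * c * (a + b + c) / 12 :=
  Real.sq_sqrt (by positivity)

/-- There are `a b` factors on each side, with squared arguments at most `D = O(t² / (a b))`, so the
quartic errors total `O(a b D²) = O(t⁴ / (a b))`. The hypothesis on `t` makes both `D` and this
total at most `1`. -/
theorem norm_boxCharFun_sub_le {a b c : ℕ} (ha : 0 < a) (hab : a ≤ b) (hbc : b ≤ c)
    {t : ℝ} (ht : 1500 * (t ^ 2 + t ^ 4) ≤ b) :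
    ‖boxCharFun a b c t - Complex.exp (-t ^ 2 / 2)‖ ≤ 3000 * t ^ 4 / b := by
  have hb : 0 < b := ha.trans_le hab
  have hc : 0 < c := hb.trans_le hbc
  have ha' : (1 : ℝ) ≤ a := by exact_mod_cast ha
  have hb' : (0 : ℝ) < b := by exact_mod_cast hb
  have hc' : (0 : ℝ) < c := by exact_mod_cast hc
  have hσ := boxStd_pos ha hb hc
  have hσ2 := sq_boxStd a b c
  have ht2 := sq_nonneg t
  have ht4 : 0 ≤ t ^ 4 := by positivity
  set s := t / boxStd a b c with hs
  have hs2 : s ^ 2 * (a * b * c ^ 2) ≤ 12 * t ^ 2 := by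
    rw [hs, div_pow, div_mul_eq_mul_div, div_le_iff₀ (by positivity), hσ2]
    have : (0 : ℝ) ≤ t ^ 2 * (a * b * c * (a + b)) := by positivity
    nlinarith
  -- All indices satisfy `n ≤ 3 c`, so `(n s / 2)²` is at most `9 c² s² / 4`, and `s² a b c² ≤ 12
  -- t²`; here `27 = 9 * 12 / 4`.
  set D : ℝ := 27 * t ^ 2 / (a * b) with hD
  have hD1 : D ≤ 1 := by
    rw [hD, div_le_one (by positivity)]
    nlinarith
  have hx : ∀ n : ℕ, n ≤ 3 * c → ((n : ℝ) * s / 2) ^ 2 ≤ D := by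
    intro n hn
    have hn' : (n : ℝ) ≤ 3 * c := by exact_mod_cast hn
    rw [hD, le_div_iff₀ (by positivity)]
    calc ((n : ℝ) * s / 2) ^ 2 * (a * b) = (n : ℝ) ^ 2 * (s ^ 2 * (a * b)) / 4 := by ring
      _ ≤ (3 * c) ^ 2 * (s ^ 2 * (a * b)) / 4 := by gcongr
      _ = 9 * (s ^ 2 * (a * b * c ^ 2)) / 4 := by ring
      _ ≤ 27 * t ^ 2 := by linarith
  obtain ⟨R, hR, hX⟩ := exists_prod_sinc_eq_exp a b
    (f := fun i j => ((i + j + c + 1 : ℕ) : ℝ) * s / 2) hD1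
    fun i hi j hj => hx (i + j + c + 1) (by omega)
  obtain ⟨R', hR', hY⟩ := exists_prod_sinc_eq_exp a b
    (f := fun i j => ((i + j + 1 : ℕ) : ℝ) * s / 2) hD1
    fun i hi j hj => hx (i + j + 1) (by omega)
  have h := boxCharFun_mul_prod a b c t
  rw [← hs, hX, hY] at h
  -- The variance identity again: the difference equals `3 s² σ²`, which after division by `6`
  -- becomes the exact Gaussian exponent `t² / 2`.
  have hsum : (∑ i ∈ Finset.range a, ∑ j ∈ Finset.range b,
        (((i + j + c + 1 : ℕ) : ℝ) * s / 2) ^ 2) -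
      ∑ i ∈ Finset.range a, ∑ j ∈ Finset.range b, (((i + j + 1 : ℕ) : ℝ) * s / 2) ^ 2 =
      3 * t ^ 2 := by
    have h1 := sum_range_range_variance a b c
    rw [← hσ2] at h1
    have h2 : t = s * boxStd a b c := by rw [hs, div_mul_cancel₀ _ hσ.ne']
    rw [h2, mul_pow, ← h1, mul_sub, mul_sub]
    simp_rw [← Finset.sum_sub_distrib, Finset.mul_sum, ← Finset.sum_sub_distrib]
    refine Finset.sum_congr rfl fun i _ => Finset.sum_congr rfl fun j _ => ?_
    push_cast
    ring
  have hφ : boxCharFun a b c t = (Real.exp (-t ^ 2 / 2 + (R - R')) : ℝ) := by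
    refine mul_right_cancel₀ (Complex.ofReal_ne_zero.2 (Real.exp_pos _).ne') (h.trans ?_)
    rw [← Complex.ofReal_mul, ← Real.exp_add]
    congr 2
    linarith
  have hRR : |R - R'| ≤ 1458 * t ^ 4 / b := by
    calc |R - R'| ≤ |R| + |R'| := abs_sub _ _
      _ ≤ 2 * (a * b * D ^ 2) := by linarith
      _ = 1458 * t ^ 4 / (a * b) := by rw [hD]; field_simp; ring
      _ ≤ 1458 * t ^ 4 / b := by
        gcongr
        nlinarith
  have hRR1 : |R - R'| ≤ 1 := hRR.trans (by rw [div_le_one hb']; nlinarith)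
  have hexp : Complex.exp (-t ^ 2 / 2) = (Real.exp (-t ^ 2 / 2) : ℝ) := by push_cast; rfl
  rw [hφ, hexp, ← Complex.ofReal_sub, Complex.norm_real, Real.norm_eq_abs, Real.exp_add,
    ← mul_sub_one, abs_mul, abs_of_pos (Real.exp_pos _)]
  calc Real.exp (-t ^ 2 / 2) * |Real.exp (R - R') - 1|
      ≤ 1 * (2 * |R - R'|) := by
        gcongr
        · rw [Real.exp_le_one_iff]; linarith
        · exact Real.abs_exp_sub_one_le hRR1
    _ ≤ 2 * (1458 * t ^ 4 / b) := by linarith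
    _ ≤ 3000 * t ^ 4 / b := by
        have : 0 ≤ t ^ 4 / b := by positivity
        rw [mul_div_assoc, mul_div_assoc]
        linarith

theorem tendsto_boxCharFun_gaussian {a b c : ℕ → ℕ} (ha : ∀ n, 0 < a n) (hb : ∀ n, 0 < b n)
    (hc : ∀ n, 0 < c n)
    (h : Tendsto (fun n => medianThree (a n) (b n) (c n)) atTop atTop) (t : ℝ) :
    Tendsto (fun n => boxCharFun (a n) (b n) (c n) t) atTop (𝓝 (Complex.exp (-t ^ 2 / 2))) := by
  have h' : Tendsto (fun n => (medianThree (a n) (b n) (c n) : ℝ)) atTop atTop :=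
    tendsto_natCast_atTop_atTop.comp h
  rw [tendsto_iff_norm_sub_tendsto_zero]
  refine squeeze_zero' (.of_forall fun n => norm_nonneg _) ?_
    (h'.const_div_atTop (3000 * t ^ 4))
  filter_upwards [h'.eventually_ge_atTop (1500 * (t ^ 2 + t ^ 4))] with n hn
  obtain ⟨a', b', c', h0, h1, h2, h3, h4⟩ := exists_sorted_boxCharFun_eq (ha n) (hb n) (hc n)
  rw [h3] at hn ⊢
  rw [h4]
  exact norm_boxCharFun_sub_le h0 h1 h2 hn

/-! ### The limit with two fixed sides, and the Irwin--Hall law. -/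

/-- For fixed `a` and `b` the standard deviation grows like `c √(a b / 12)`. Hence every denominator
argument tends to `0`, and all `a b` numerator arguments tend to the same limit, whatever `i` and
`j` are. -/
theorem tendsto_boxCharFun_sinc {a b : ℕ} (ha : 0 < a) (hb : 0 < b) (t : ℝ) :
    Tendsto (fun c => boxCharFun a b c t) atTop
      (𝓝 ((Real.sinc (t / Real.sqrt ((a * b : ℕ) / 12) / 2) ^ (a * b) : ℝ) : ℂ)) := by
  have ha' : (0 : ℝ) < a := by exact_mod_cast ha
  have hb' : (0 : ℝ) < b := by exact_mod_cast hb
  have hcast : Tendsto (fun c : ℕ => (c : ℝ)) atTop atTop := tendsto_natCast_atTop_atTop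
  have hσc : Tendsto (fun c : ℕ => boxStd a b c / c) atTop (𝓝 (Real.sqrt ((a * b : ℕ) / 12))) := by
    have h1 : Tendsto (fun c : ℕ => Real.sqrt ((a * b : ℕ) * ((a + b) / (c : ℝ) + 1) / 12)) atTop
        (𝓝 (Real.sqrt ((a * b : ℕ) * (0 + 1) / 12))) :=
      (((hcast.const_div_atTop _).add_const 1).const_mul _ |>.div_const 12).sqrt
    simp only [zero_add, mul_one] at h1
    refine h1.congr' ?_
    filter_upwards [eventually_gt_atTop 0] with c hc
    have hc' : (0 : ℝ) < c := by exact_mod_cast hc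
    have hmul : ∀ x : ℝ, Real.sqrt x * c = Real.sqrt (x * (c : ℝ) ^ 2) := fun x => by
      rw [Real.sqrt_mul' _ (sq_nonneg _), Real.sqrt_sq hc'.le]
    rw [eq_div_iff hc'.ne', boxStd, hmul]
    congr 1
    push_cast
    field_simp
  have hpos : 0 < Real.sqrt ((a * b : ℕ) / 12) := by
    have : (0 : ℝ) < (a * b : ℕ) := by positivity
    positivity
  have hcσ : Tendsto (fun c : ℕ => (c : ℝ) / boxStd a b c) atTop
      (𝓝 (Real.sqrt ((a * b : ℕ) / 12))⁻¹) := by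
    refine (hσc.inv₀ hpos.ne').congr fun c => by rw [inv_div]
  have hσ0 : Tendsto (fun c : ℕ => 1 / boxStd a b c) atTop (𝓝 0) := by
    have h1 := hcσ.mul (hcast.const_div_atTop 1)
    rw [mul_zero] at h1
    refine h1.congr' ?_
    filter_upwards [eventually_gt_atTop 0] with c hc
    have hc' : (0 : ℝ) < c := by exact_mod_cast hc
    field_simp
  have hy : Tendsto (fun c : ℕ => ∏ i ∈ Finset.range a, ∏ j ∈ Finset.range b,
      Real.sinc ((i + j + 1 : ℕ) * (t / boxStd a b c) / 2)) atTop (𝓝 1) := by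
    have : (1 : ℝ) = ∏ i ∈ Finset.range a, ∏ j ∈ Finset.range b,
        Real.sinc ((i + j + 1 : ℕ) * (t * 0) / 2) := by simp
    rw [this]
    refine tendsto_finsetProd _ fun i _ => tendsto_finsetProd _ fun j _ => ?_
    refine (Real.continuous_sinc.tendsto _).comp (Tendsto.div_const (Tendsto.const_mul _ ?_) _)
    refine (hσ0.const_mul t).congr fun c => by rw [mul_one_div]
  have hx : Tendsto (fun c : ℕ => ∏ i ∈ Finset.range a, ∏ j ∈ Finset.range b,
      Real.sinc ((i + j + c + 1 : ℕ) * (t / boxStd a b c) / 2)) atTop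
      (𝓝 (Real.sinc (t / Real.sqrt ((a * b : ℕ) / 12) / 2) ^ (a * b))) := by
    have : Real.sinc (t / Real.sqrt ((a * b : ℕ) / 12) / 2) ^ (a * b) =
        ∏ i ∈ Finset.range a, ∏ j ∈ Finset.range b,
        Real.sinc (t / Real.sqrt ((a * b : ℕ) / 12) / 2) := by
      simp [mul_comm a b, pow_mul]
    rw [this]
    refine tendsto_finsetProd _ fun i _ => tendsto_finsetProd _ fun j _ => ?_
    refine (Real.continuous_sinc.tendsto _).comp (Tendsto.div_const ?_ _)
    have h1 := ((hσ0.const_mul (i + j + 1 : ℝ)).add hcσ).const_mul t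
    rw [mul_zero, zero_add, ← div_eq_mul_inv] at h1
    refine h1.congr fun c => ?_
    push_cast
    ring
  have hxy := hx.div hy one_ne_zero
  rw [div_one] at hxy
  refine ((Complex.continuous_ofReal.tendsto _).comp hxy).congr' ?_
  filter_upwards [hy.eventually_ne one_ne_zero] with c hc
  have h := boxCharFun_mul_prod a b c t
  simp only [Function.comp_apply, Pi.div_apply, Complex.ofReal_div]
  rw [← h, mul_div_cancel_right₀ _ (Complex.ofReal_ne_zero.2 hc)]

end PlanePartition

theorem integral_uniformUnit {E : Type*} [NormedAddCommGroup E] [NormedSpace ℝ E] (f : ℝ → E) :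
    ∫ x, f x ∂uniformUnit = ∫ x in (0 : ℝ)..1, f x := by
  rw [uniformUnit, intervalIntegral.integral_of_le zero_le_one, integral_Icc_eq_integral_Ioc]

theorem memLp_id_uniformUnit : MemLp (id : ℝ → ℝ) 2 uniformUnit := by
  refine MemLp.of_bound measurable_id.aestronglyMeasurable 1 ?_
  rw [uniformUnit]
  filter_upwards [ae_restrict_mem measurableSet_Icc] with x hx
  rw [id, Real.norm_eq_abs, abs_of_nonneg hx.1]
  exact hx.2

theorem integral_id_uniformUnit : ∫ x, x ∂uniformUnit = 1 / 2 := by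
  rw [integral_uniformUnit, integral_id]
  norm_num

theorem variance_id_uniformUnit : variance (id : ℝ → ℝ) uniformUnit = 1 / 12 := by
  rw [variance_eq_sub memLp_id_uniformUnit]
  simp only [Pi.pow_apply, id, integral_id_uniformUnit]
  rw [integral_uniformUnit, integral_pow]
  norm_num

theorem charFun_uniformUnit (s : ℝ) :
    charFun uniformUnit s = Complex.exp (s / 2 * Complex.I) * Real.sinc (s / 2) := by
  rw [charFun_apply_real, integral_uniformUnit]
  rcases eq_or_ne s 0 with rfl | hs
  · simp
  have hs' : (s : ℂ) * Complex.I ≠ 0 := mul_ne_zero (by exact_mod_cast hs) Complex.I_ne_zero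
  have h := integral_exp_mul_complex (a := 0) (b := 1) hs'
  have hs2 : (s : ℂ) ≠ 0 := by exact_mod_cast hs
  calc ∫ x in (0 : ℝ)..1, Complex.exp (s * x * Complex.I)
      = ∫ x in (0 : ℝ)..1, Complex.exp (s * Complex.I * x) := by
        congr 1; ext x; congr 1; ring
    _ = _ := by
        rw [h, Real.sinc_of_ne_zero (by positivity)]
        push_cast
        rw [Complex.sin]
        have e : (s : ℂ) * Complex.I * 1 = s / 2 * Complex.I + s / 2 * Complex.I := by ring
        rw [e, Complex.exp_add, mul_zero, Complex.exp_zero, neg_mul, Complex.exp_neg]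
        have := Complex.exp_ne_zero ((s : ℂ) / 2 * Complex.I)
        generalize Complex.exp ((s : ℂ) / 2 * Complex.I) = E at this ⊢
        field_simp
        linear_combination (E ^ 2 - 1) * Complex.I_sq

theorem charFun_irwinHall (M : ℕ) (s : ℝ) :
    charFun (irwinHall M) s =
      Complex.exp (M * (s / 2) * Complex.I) * (Real.sinc (s / 2) ^ M : ℝ) := by
  rw [irwinHall, charFun_map_sum_pi_eq_prod]
  simp only [Finset.prod_apply, charFun_uniformUnit, Finset.prod_const, Finset.card_univ,
    Fintype.card_fin, mul_pow, ← Complex.exp_nat_mul]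
  push_cast
  congr 2
  ring

theorem integral_irwinHall (M : ℕ) : ∫ x, x ∂irwinHall M = M / 2 := by
  have hi : ∀ i : Fin M, Integrable (fun u : Fin M → ℝ => u i)
      (Measure.pi fun _ : Fin M => uniformUnit) := fun i =>
    integrable_comp_eval (μ := fun _ : Fin M => uniformUnit) (i := i) (f := fun x : ℝ => x)
      (memLp_id_uniformUnit.integrable one_le_two)
  rw [irwinHall, integral_map (by fun_prop) (by fun_prop), integral_finsetSum _ fun i _ => hi i]
  have h : ∀ i : Fin M, ∫ u, u i ∂(Measure.pi fun _ : Fin M => uniformUnit) = 1 / 2 := fun i => by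
    rw [← integral_id_uniformUnit]
    exact integral_comp_eval (μ := fun _ : Fin M => uniformUnit) (i := i) (f := fun x : ℝ => x)
      (by fun_prop)
  simp [h]
  ring

theorem variance_irwinHall (M : ℕ) : variance (id : ℝ → ℝ) (irwinHall M) = M / 12 := by
  have h := variance_sum_pi (μ := fun _ : Fin M => uniformUnit) (X := fun _ => id)
    fun _ => memLp_id_uniformUnit
  rw [irwinHall, variance_map (by fun_prop) (by fun_prop)]
  simp only [variance_id_uniformUnit] at h
  have e : (id : ℝ → ℝ) ∘ (fun u : Fin M → ℝ => ∑ i, u i) =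
      ∑ i, fun u : Fin M → ℝ => id (u i) := by
    ext u; simp
  rw [e, h]
  simp
  ring

theorem charFun_map_standardize_irwinHall (M : ℕ) (t : ℝ) :
    charFun ((irwinHall M).map (standardize id (irwinHall M))) t =
      (Real.sinc (t / Real.sqrt (M / 12) / 2) ^ M : ℝ) := by
  have hs : standardize id (irwinHall M) = fun x : ℝ => (x - M / 2) / Real.sqrt (M / 12) := by
    unfold standardize
    simp only [id, integral_irwinHall]
    rw [← variance_irwinHall]
  have h1 := charFun_irwinHall M (t / Real.sqrt (M / 12))
  rw [hs, charFun_apply_real, integral_map (by fun_prop) (by fun_prop)]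
  rw [charFun_apply_real] at h1
  have h2 : ∀ x : ℝ, Complex.exp (t * ((x - M / 2) / Real.sqrt (M / 12) : ℝ) * Complex.I) =
      Complex.exp ((t / Real.sqrt (M / 12) : ℝ) * x * Complex.I) *
        Complex.exp (-(M * ((t / Real.sqrt (M / 12) : ℝ) / 2) * Complex.I)) := by
    intro x
    rw [← Complex.exp_add]
    congr 1
    push_cast
    ring
  simp_rw [h2]
  rw [integral_mul_const, h1, mul_right_comm, ← Complex.exp_add, add_neg_cancel, Complex.exp_zero,
    one_mul]

/-! ### Convergence in distribution through characteristic functions. -/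

theorem tendstoInDistribution_iff_charFun {Ω : ℕ → Type*} {Ω' : Type*}
    [∀ n, MeasurableSpace (Ω n)] [MeasurableSpace Ω'] {X : ∀ n, Ω n → ℝ} {Z : Ω' → ℝ}
    {P : ∀ n, Measure (Ω n)} [∀ n, IsProbabilityMeasure (P n)] {P' : Measure Ω'}
    [IsProbabilityMeasure P'] (hX : ∀ n, AEMeasurable (X n) (P n)) (hZ : AEMeasurable Z P') :
    TendstoInDistribution X atTop Z P P' ↔
      ∀ t, Tendsto (fun n => charFun ((P n).map (X n)) t) atTop (𝓝 (charFun (P'.map Z) t)) := by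
  constructor
  · intro h
    exact ProbabilityMeasure.tendsto_iff_tendsto_charFun.1 h.tendsto
  · intro h
    exact ⟨hX, hZ, ProbabilityMeasure.tendsto_iff_tendsto_charFun.2 h⟩

theorem measurable_standardize_irwinHall (M : ℕ) :
    Measurable (standardize (id : ℝ → ℝ) (irwinHall M)) := by
  unfold standardize
  fun_prop

open PlanePartition

theorem tendstoInDistribution_size_gaussian {a b c : ℕ → ℕ} (ha : ∀ n, 0 < a n)
    (hb : ∀ n, 0 < b n) (hc : ∀ n, 0 < c n)
    (h : Tendsto (fun n => medianThree (a n) (b n) (c n)) atTop atTop) :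
    TendstoInDistribution
      (fun n => standardize (fun ρ : PlanePartition => (ρ.size : ℝ))
        (uniformBox (a n) (b n) (c n))) atTop (id : ℝ → ℝ)
      (fun n => uniformBox (a n) (b n) (c n)) (gaussianReal 0 1) := by
  rw [tendstoInDistribution_iff_charFun (fun n => Measurable.of_discrete.aemeasurable)
    aemeasurable_id]
  intro t
  simp_rw [charFun_map_standardize_size]
  convert tendsto_boxCharFun_gaussian ha hb hc h t using 2
  rw [Measure.map_id, charFun_gaussianReal]
  congr 1
  push_cast
  ring

/-- A convergent sequence of integers is eventually constant, but `(a n, b n)` may keep wandering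
among the factorizations of `M`. These are finitely many and the limit depends only on the product,
so convergence in `c` is uniform over them. -/
theorem tendstoInDistribution_size_irwinHall {a b c : ℕ → ℕ} (ha : ∀ n, 0 < a n)
    (hb : ∀ n, 0 < b n) {M : ℕ}
    (hM : Tendsto (fun n => (a n : ℝ) * (b n : ℝ)) atTop (𝓝 (M : ℝ)))
    (h : Tendsto c atTop atTop) :
    TendstoInDistribution
      (fun n => standardize (fun ρ : PlanePartition => (ρ.size : ℝ))
        (uniformBox (a n) (b n) (c n))) atTop (standardize (id : ℝ → ℝ) (irwinHall M))
      (fun n => uniformBox (a n) (b n) (c n)) (irwinHall M) := by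
  rw [tendstoInDistribution_iff_charFun (fun n => Measurable.of_discrete.aemeasurable)
    (measurable_standardize_irwinHall M).aemeasurable]
  intro t
  simp_rw [charFun_map_standardize_size, charFun_map_standardize_irwinHall]
  have hM' : ∀ᶠ n in atTop, a n * b n = M := by
    have h1 : Tendsto (fun n => ((a n * b n : ℕ) : ℝ)) atTop (𝓝 ((M : ℕ) : ℝ)) := by
      simpa using hM
    have h2 := (Nat.isClosedEmbedding_coe_real.isEmbedding.tendsto_nhds_iff).2 h1
    rwa [nhds_discrete, tendsto_pure] at h2
  rw [tendsto_nhds]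
  intro U hU hmem
  have hfin : ∀ᶠ k in atTop, ∀ p ∈ M.divisorsAntidiagonal, boxCharFun p.1 p.2 k t ∈ U := by
    rw [Finset.eventually_all]
    intro p hp
    obtain ⟨h1, h2⟩ := Nat.mem_divisorsAntidiagonal.1 hp
    have h3 := tendsto_boxCharFun_sinc (a := p.1) (b := p.2)
      (Nat.pos_of_ne_zero fun h0 => h2 (by rw [← h1, h0, zero_mul]))
      (Nat.pos_of_ne_zero fun h0 => h2 (by rw [← h1, h0, mul_zero])) t
    rw [h1] at h3
    exact h3.eventually (hU.mem_nhds hmem)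
  filter_upwards [hM', h.eventually hfin] with n hn1 hn2
  refine hn2 (a n, b n) (Nat.mem_divisorsAntidiagonal.2 ⟨hn1, ?_⟩)
  rw [← hn1]
  exact (Nat.mul_pos (ha n) (hb n)).ne'

/-! ### Necessity of a median tending to infinity. -/

theorem mul_mul_le_sq_medianThree_mul (a b c : ℕ) :
    a * b * c ≤ medianThree a b c ^ 2 * (a + b + c) := by
  have key : ∀ {x y z : ℕ}, x ≤ y → y ≤ z → x * y * z ≤ y ^ 2 * (x + y + z) := by
    intro x y z hxy _
    calc x * y * z ≤ y * y * z := by gcongr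
      _ ≤ y ^ 2 * (x + y + z) := by nlinarith [Nat.zero_le (y ^ 2 * (x + y))]
  have left : ∀ {x y z : ℕ}, x * y * z ≤ medianThree x y z ^ 2 * (x + y + z) →
      y * x * z ≤ medianThree y x z ^ 2 * (y + x + z) := by
    intro x y z h
    rwa [medianThree_swap_left y x z, mul_comm y x, add_comm y x]
  have right : ∀ {x y z : ℕ}, x * y * z ≤ medianThree x y z ^ 2 * (x + y + z) →
      x * z * y ≤ medianThree x z y ^ 2 * (x + z + y) := by
    intro x y z h
    rwa [medianThree_swap_right x z y, mul_right_comm x z y, add_right_comm x z y]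
  have sorted : ∀ {x y z : ℕ}, x ≤ y → y ≤ z →
      x * y * z ≤ medianThree x y z ^ 2 * (x + y + z) := by
    intro x y z h1 h2
    rw [medianThree_of_le h1 h2]
    exact key h1 h2
  rcases le_total a b with h1 | h1 <;> rcases le_total b c with h2 | h2 <;>
    rcases le_total a c with h3 | h3
  · exact sorted h1 h2
  · exact sorted h1 h2
  · exact right (sorted h3 h2)
  · exact right (left (sorted h3 h1))
  · exact left (sorted h1 h3)
  · exact left (right (sorted h2 h3))
  all_goals exact left (right (left (sorted h2 h1)))

theorem PlanePartition.abs_standardize_size_le {ρ : PlanePartition} {a b c : ℕ}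
    (hρ : ρ ∈ box a b c) (ha : 0 < a) (hb : 0 < b) (hc : 0 < c) :
    |standardize (fun ρ : PlanePartition => (ρ.size : ℝ)) (uniformBox a b c) ρ| ≤
      2 * medianThree a b c := by
  have hσ := boxStd_pos ha hb hc
  have h1 : (ρ.size : ℝ) ≤ a * b * c := by exact_mod_cast size_le hρ
  have h0 : (0 : ℝ) ≤ ρ.size := Nat.cast_nonneg _
  have hm : (a * b * c : ℝ) ≤ medianThree a b c ^ 2 * (a + b + c) := by
    exact_mod_cast mul_mul_le_sq_medianThree_mul a b c
  have hpos : (0 : ℝ) < a * b * c := by positivity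
  rw [standardize_size]
  simp only
  rw [abs_div, abs_of_pos hσ, div_le_iff₀ hσ]
  calc |(ρ.size : ℝ) - a * b * c / 2| ≤ a * b * c / 2 := by rw [abs_le]; constructor <;> linarith
    -- Squaring, `(a b c)² / 4 ≤ 3 m² σ²` for `m` the median; the constant `2` rounds up `√3`.
    _ ≤ 2 * medianThree a b c * boxStd a b c := by
        refine le_of_sq_le_sq ?_ (by positivity)
        rw [mul_pow, sq_boxStd]
        nlinarith [mul_le_mul_of_nonneg_left hm hpos.le]

theorem gaussianReal_lt_abs_pos (K : ℝ) : 0 < gaussianReal 0 1 {x : ℝ | K < |x|} := by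
  rw [pos_iff_ne_zero]
  intro h
  have h1 := gaussianReal_absolutelyContinuous' 0 one_ne_zero h
  have hU : IsOpen {x : ℝ | K < |x|} := isOpen_lt continuous_const continuous_abs
  refine (hU.measure_pos volume ⟨|K| + 1, ?_⟩).ne' h1
  rw [Set.mem_ofPred_eq, abs_of_pos (by positivity)]
  linarith [le_abs_self K]

/-- If the median is below `K` infinitely often, the open set `2 K < |x|` has mass zero infinitely
often, so the liminf of its masses is zero. The portmanteau theorem would then make it null for the
Gaussian, which has full support. -/
theorem tendsto_medianThree_of_tendstoInDistribution {a b c : ℕ → ℕ} (ha : ∀ n, 0 < a n)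
    (hb : ∀ n, 0 < b n) (hc : ∀ n, 0 < c n)
    (h : TendstoInDistribution
      (fun n => standardize (fun ρ : PlanePartition => (ρ.size : ℝ))
        (uniformBox (a n) (b n) (c n))) atTop (id : ℝ → ℝ)
      (fun n => uniformBox (a n) (b n) (c n)) (gaussianReal 0 1)) :
    Tendsto (fun n => medianThree (a n) (b n) (c n)) atTop atTop := by
  by_contra hmed
  rw [tendsto_atTop] at hmed
  push Not at hmed
  obtain ⟨K, hK⟩ := hmed
  have hU : IsOpen {x : ℝ | 2 * (K : ℝ) < |x|} := isOpen_lt continuous_const continuous_abs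
  have h1 := ProbabilityMeasure.le_liminf_measure_open_of_tendsto h.tendsto hU
  simp only [ProbabilityMeasure.coe_mk, Measure.map_id] at h1
  have h2 : liminf (fun n => (uniformBox (a n) (b n) (c n)).map
      (standardize (fun ρ : PlanePartition => (ρ.size : ℝ)) (uniformBox (a n) (b n) (c n)))
        {x : ℝ | 2 * (K : ℝ) < |x|}) atTop ≤ 0 := by
    refine liminf_le_of_frequently_le' (hK.mono fun n hn => le_of_eq ?_)
    rw [Measure.map_apply Measurable.of_discrete hU.measurableSet]
    refine measure_eq_zero_iff_ae_notMem.2 ?_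
    filter_upwards [ae_mem_box (a n) (b n) (c n)] with ρ hρ
    have h3 := abs_standardize_size_le hρ (ha n) (hb n) (hc n)
    have h4 : (medianThree (a n) (b n) (c n) : ℝ) ≤ K := by exact_mod_cast hn.le
    simp only [Set.mem_preimage, Set.mem_ofPred_eq, not_lt]
    linarith
  exact absurd (h1.trans h2) (not_le.2 (gaussianReal_lt_abs_pos _))

theorem theorem1p5 (a b c : ℕ → ℕ)
    (ha : ∀ n, 0 < a n) (hb : ∀ n, 0 < b n) (hc : ∀ n, 0 < c n) :
    -- (i) asymptotic normality holds exactly when the median side length tends to infinity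
    (TendstoInDistribution
        (fun n => standardize (fun ρ : PlanePartition => (ρ.size : ℝ))
          (PlanePartition.uniformBox (a n) (b n) (c n)))
        atTop (id : ℝ → ℝ)
        (fun n => PlanePartition.uniformBox (a n) (b n) (c n)) (gaussianReal 0 1) ↔
      Tendsto (fun n => medianThree (a n) (b n) (c n)) atTop atTop) ∧
    -- (ii) the Irwin--Hall limit
    (∀ M : ℕ, Tendsto (fun n => (a n : ℝ) * (b n : ℝ)) atTop (𝓝 (M : ℝ)) →
      Tendsto c atTop atTop →
      TendstoInDistribution
        (fun n => standardize (fun ρ : PlanePartition => (ρ.size : ℝ))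
          (PlanePartition.uniformBox (a n) (b n) (c n)))
        atTop (standardize (id : ℝ → ℝ) (irwinHall M))
        (fun n => PlanePartition.uniformBox (a n) (b n) (c n)) (irwinHall M)) := by
  exact ⟨⟨tendsto_medianThree_of_tendstoInDistribution ha hb hc,
    tendstoInDistribution_size_gaussian ha hb hc⟩,
    fun M => tendstoInDistribution_size_irwinHall ha hb⟩
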